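/- **Setting.** Let $(\mathcal N,\mathcal E)$ be a finite (weakly) connected directed graph with $\mathcal N\neq\emptyset$ and such that $(j,k)\in\mathcal E$ implies $(k,j)\notin\mathcal E$; let $C$ be its incidence matrix ($C_{j,e}=1$ if $e=(j,k)$, $C_{j,e}=-1$ if $e=(k,j)$, and $0$ otherwise). Let $B=\mathrm{diag}(B_e)$, $M=\mathrm{diag}(M_j)$, $D=\mathrm{diag}(D_j)$ have positive diagonals, let $d\in\mathbb R^{|\mathcal N|}$ and $\underline F,\overline F\in\mathbb R^{|\mathcal E|}$. Put $L=CBC^T$, let $L^\dagger$ be its Moore–Penrose inverse, $H^T=\begin{bmatrix}BC^TL^\dagger\\-BC^TL^\dagger\end{bmatrix}$ and $F=\begin{bmatrix}\overline F\\-\underline F\end{bmatrix}$. Let $J_j(x)=\frac{c_j}{2}x^2+\bar c_jx$ with $c_j>0$, so $(\nabla J_j)^{-1}(y)=(y-\bar c_j)/c_j$, and let $T^{\hat q},T^\alpha,T^\eta$ be diagonal with positive entries and $T^\lambda>0$. For real vectors, $[y]^+_u$ denotes the vector with entries $y_e$ if $y_e>0$ or $u_e>0$, and $0$ otherwise. The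 planner's problem is $$\min_{p,q,\omega,\tilde\theta}\ \mathbf 1^TJ(p)+\tfrac12\omega^TD\omega\quad\text{s.t.}\quad q=p,\ \ \mathbf 1^T(q-d)=0,\ \ H^T(q-d)\le F,\ \ q-d-D\omega-CB\tilde\theta=0,$$ with Lagrangian $\mathbf 1^TJ(p)+\frac12\omega^TD\omega+\nu^T(q-d-D\omega-CB\tilde\theta)+\alpha^T(q-p)-\lambda\mathbf 1^T(q-d)+\eta^T(H^T(q-d)-F)$, $\eta\ge0$. Assume that this problem is feasible. An optimal primal-dual solution is an optimal $(p,q,\omega,\tilde\theta)$ together with $(\alpha,\lambda,\eta\ge0,\nu)$ such that the two form a min-max saddle point of the Lagrangian. For $\rho>0$ the regularized misaligned price-bidding loop has state $z=(\hat q,\tilde\theta)$, $\sigma=(\lambda,\omega,\alpha,\eta)$. With $\pi=\lambda\mathbf 1-H\eta-\omega$ and $q=\frac1\rho(\pi-\alpha)+\hat q$ it reads $$T^{\hat q}\dot{\hat q}=\pi-\alpha,\quad \dot{\tilde\theta}=C^T\omega,\quad T^\lambda\dot\lambda=-\mathbf 1^T(q-d),\quad M\dot\omega=q-d-D\omega-CB\tilde\theta,$$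 $$T^\alpha\dot\alpha=q-(\nabla J)^{-1}(\pi),\quad T^\eta\dot\eta=\left[H^T(q-d)-F\right]^+_\eta .$$ Trajectories on $[0,\infty)$ are Carathéodory solutions (locally absolutely continuous, satisfying the equations for almost every $t\ge0$). Let $\mathbb I=\{(z,\sigma):\eta\ge0\}$, and let $\mathbb E$ be the set of points of $\mathbb I$ at which the right-hand side vanishes. **Theorem.** Let $\rho\in(0,\inf_{j\in\mathcal N}4c_j)$. Then $\mathbb E$ is nonempty and globally asymptotically stable on $\mathbb I$: for every $\varepsilon>0$ there is $\delta>0$ such that every trajectory starting in $\mathbb I$ at distance less than $\delta$ from $\mathbb E$ stays at distance less than $\varepsilon$ from $\mathbb E$ for all $t\ge0$, and for every trajectory starting in $\mathbb I$ the distance to $\mathbb E$ tends to $0$ as $t\to\infty$. Moreover, from every initial point in $\mathbb I$ a trajectory exists, and every such trajectory $(z(t),\sigma(t))$ is bounded for $t\ge0$ and converges, as $t\to\infty$, to a single equilibrium $(z^*,\sigma^*)\in\mathbb E$. This equilibrium is optimal: with $\pi^*=\lambda^*\mathbf 1-H\eta^*-\omega^*$, $p^*=(\nabla J)^{-1}(\pi^*)$,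 $q^*=\frac1\rho(\pi^*-\alpha^*)+\hat q^*$ and $\nu^*=\omega^*$, the points $(p^*,q^*,\omega^*,\tilde\theta^*)$ and $(\alpha^*,\lambda^*,\eta^*,\nu^*)$ form an optimal primal-dual solution of the planner's problem. -/

import Mathlib

open Matrix Filter Topology MeasureTheory

/-- `X` is a Moore–Penrose inverse of the real matrix `A` (the four Penrose equations). -/
structure IsMoorePenroseInverse {m n : Type*} [Fintype m] [Fintype n]
    (A : Matrix m n ℝ) (X : Matrix n m ℝ) : Prop where
  mul_mul_self : A * X * A = A
  self_mul_mul : X * A * X = X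
  symm_left : (A * X)ᵀ = A * X
  symm_right : (X * A)ᵀ = X * A

theorem IsMoorePenroseInverse.unique {m n : Type*} [Fintype m] [Fintype n]
    {A : Matrix m n ℝ} {X Y : Matrix n m ℝ}
    (hX : IsMoorePenroseInverse A X) (hY : IsMoorePenroseInverse A Y) : X = Y := by
  have h1 : A * X = A * Y := by
    calc A * X = (A * X)ᵀ := hX.symm_left.symm
      _ = (A * Y * A * X)ᵀ := by rw [hY.mul_mul_self]
      _ = (A * X)ᵀ * (A * Y)ᵀ := by rw [Matrix.mul_assoc (A * Y), transpose_mul]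
      _ = A * X * A * Y := by rw [hX.symm_left, hY.symm_left, ← Matrix.mul_assoc]
      _ = A * Y := by rw [hX.mul_mul_self]
  have h2 : X * A = Y * A := by
    calc X * A = (X * A)ᵀ := hX.symm_right.symm
      _ = ((X * A) * (Y * A))ᵀ := by
          rw [Matrix.mul_assoc X A, ← Matrix.mul_assoc A Y A, hY.mul_mul_self]
      _ = (Y * A)ᵀ * (X * A)ᵀ := transpose_mul _ _
      _ = Y * A * (X * A) := by rw [hX.symm_right, hY.symm_right]
      _ = Y * A := by
          rw [Matrix.mul_assoc Y A, ← Matrix.mul_assoc A X A, hX.mul_mul_self]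
  calc X = X * A * X := hX.self_mul_mul.symm
    _ = Y * (A * X) := by rw [h2, Matrix.mul_assoc]
    _ = Y * A * Y := by rw [h1, ← Matrix.mul_assoc]
    _ = Y := hY.self_mul_mul

/-- Every real symmetric matrix has a Moore–Penrose inverse. -/
theorem exists_isMoorePenroseInverse_of_symm {n : Type*} [Fintype n] [DecidableEq n]
    (A : Matrix n n ℝ) (hA : Aᵀ = A) : ∃ X, IsMoorePenroseInverse A X := by
  have hH : A.IsHermitian := by
    rw [Matrix.IsHermitian, conjTranspose_eq_transpose_of_trivial, hA]
  set U : Matrix n n ℝ := (hH.eigenvectorUnitary : Matrix n n ℝ)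
  set v : n → ℝ := hH.eigenvalues
  have hUU : Uᵀ * U = 1 := by
    have h := Unitary.coe_star_mul_self hH.eigenvectorUnitary
    rwa [star_eq_conjTranspose, conjTranspose_eq_transpose_of_trivial] at h
  have hAe : A = U * diagonal v * Uᵀ := by
    have h := hH.spectral_theorem
    rw [Unitary.conjStarAlgAut_apply, star_eq_conjTranspose,
      conjTranspose_eq_transpose_of_trivial] at h
    exact h
  have key : ∀ a b : n → ℝ, (U * diagonal a * Uᵀ) * (U * diagonal b * Uᵀ)
      = U * diagonal (fun i => a i * b i) * Uᵀ := by
    intro a b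
    calc _ = U * diagonal a * (Uᵀ * U) * diagonal b * Uᵀ := by simp only [Matrix.mul_assoc]
      _ = _ := by rw [hUU, Matrix.mul_one, Matrix.mul_assoc U, diagonal_mul_diagonal]
  have ht : ∀ a : n → ℝ, (U * diagonal a * Uᵀ)ᵀ = U * diagonal a * Uᵀ := by
    intro a
    rw [transpose_mul, transpose_mul, transpose_transpose, diagonal_transpose, Matrix.mul_assoc]
  refine ⟨U * diagonal (fun i => (v i)⁻¹) * Uᵀ, ?_⟩
  rw [hAe]
  constructor
  · rw [key, key]; congr; funext i; exact mul_inv_mul_cancel (v i)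
  · rw [key, key]; congr; funext i
    simpa using mul_inv_mul_cancel ((v i)⁻¹)
  · rw [key, ht]
  · rw [key, ht]

/-- The Moore–Penrose inverse `A†` of a real matrix. -/
noncomputable def moorePenroseInverse {m n : Type*} [Fintype m] [Fintype n]
    (A : Matrix m n ℝ) : Matrix n m ℝ :=
  Classical.epsilon (IsMoorePenroseInverse A)

theorem moorePenroseInverse_spec_of_symm {n : Type*} [Fintype n] [DecidableEq n]
    (A : Matrix n n ℝ) (hA : Aᵀ = A) : IsMoorePenroseInverse A (moorePenroseInverse A) :=
  Classical.epsilon_spec (exists_isMoorePenroseInverse_of_symm A hA)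

/-- The scalar projection `[y]⁺_u`: it equals `y` if `y > 0` or `u > 0`, and `0` otherwise. -/
noncomputable def posProj (y u : ℝ) : ℝ :=
  open Classical in if 0 < y ∨ 0 < u then y else 0

/-- The data of the problem: a connected directed graph on the bus set `N` with line set `lines`
(each line carries one arbitrary orientation), the physical constants of the network, the demand,
the thermal limits, the quadratic cost coefficients and the time constants. -/
structure PowerMarket (N : Type*) [Fintype N] [DecidableEq N] where
  /-- The set of oriented lines. -/
  lines : Finset (N × N)
  oriented : ∀ j k, (j, k) ∈ lines → (k, j) ∉ lines
  connected : (SimpleGraph.fromRel fun j k => (j, k) ∈ lines).Connected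
  /-- Line sensitivities. -/
  B : lines → ℝ
  B_pos : ∀ e, 0 < B e
  /-- Inertia. -/
  M : N → ℝ
  M_pos : ∀ j, 0 < M j
  /-- Damping. -/
  D : N → ℝ
  D_pos : ∀ j, 0 < D j
  /-- Demand. -/
  d : N → ℝ
  /-- Lower thermal limits. -/
  Flo : lines → ℝ
  /-- Upper thermal limits. -/
  Fhi : lines → ℝ
  /-- Quadratic cost coefficients. -/
  c : N → ℝ
  c_pos : ∀ j, 0 < c j
  /-- Linear cost coefficients. -/
  cbar : N → ℝ
  /-- Time constants of the virtual dispatch. -/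
  τq : N → ℝ
  τq_pos : ∀ j, 0 < τq j
  /-- Time constants of the price bids. -/
  τα : N → ℝ
  τα_pos : ∀ j, 0 < τα j
  /-- Time constant of the multiplier of the network power balance. -/
  τl : ℝ
  τl_pos : 0 < τl
  /-- Time constants of the multipliers of the thermal limits. -/
  τη : lines ⊕ lines → ℝ
  τη_pos : ∀ e, 0 < τη e

namespace PowerMarket

variable {N : Type*} [Fintype N] [DecidableEq N] (G : PowerMarket N)

/-- The incidence matrix `C`. -/
def C : Matrix N G.lines ℝ :=
  Matrix.of fun j e => if (e : N × N).1 = j then 1 else if (e : N × N).2 = j then -1 else 0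

/-- The weighted Laplacian `L = C B Cᵀ`. -/
def laplacian : Matrix N N ℝ := G.C * diagonal G.B * G.Cᵀ

theorem laplacian_symm : G.laplacianᵀ = G.laplacian := by
  simp [laplacian, transpose_mul, Matrix.mul_assoc]

theorem isMoorePenroseInverse_laplacian :
    IsMoorePenroseInverse G.laplacian (moorePenroseInverse G.laplacian) :=
  moorePenroseInverse_spec_of_symm _ G.laplacian_symm

/-- The power injection shift matrix `B Cᵀ L†`. -/
noncomputable def shift : Matrix G.lines N ℝ :=
  diagonal G.B * G.Cᵀ * moorePenroseInverse G.laplacian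

/-- The matrix `H`, whose transpose stacks the shift matrix and its negative. -/
noncomputable def H : Matrix N (G.lines ⊕ G.lines) ℝ :=
  (Matrix.fromRows G.shift (-G.shift))ᵀ

/-- The stacked limits `F`: upper limits, then negated lower limits. -/
def F : G.lines ⊕ G.lines → ℝ := Sum.elim G.Fhi (-G.Flo)

/-- The cost `J_j(x) = (c_j / 2) x² + c̄_j x` of generator `j`. -/
noncomputable def cost (j : N) (x : ℝ) : ℝ := G.c j / 2 * x ^ 2 + G.cbar j * x

/-- The inverse marginal cost `(∇J_j)⁻¹(y)`, see `deriv_cost_eq_iff`. -/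
noncomputable def invMarginalCost (j : N) (y : ℝ) : ℝ := (y - G.cbar j) / G.c j

theorem deriv_cost_eq_iff (j : N) (x y : ℝ) :
    deriv (G.cost j) x = y ↔ x = G.invMarginalCost j y := by
  have h : HasDerivAt (G.cost j) (G.c j / 2 * (2 * x) + G.cbar j) x := by
    have h1 := ((hasDerivAt_pow 2 x).const_mul (G.c j / 2)).add
      ((hasDerivAt_id x).const_mul (G.cbar j))
    refine (h1.congr_deriv (by simp)).congr_of_eventuallyEq (Eventually.of_forall fun y => ?_)
    simp [cost]
  rw [h.deriv, invMarginalCost, eq_div_iff (G.c_pos j).ne']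
  constructor <;> intro h <;> linarith

/-! ### The planner's problem -/

/-- Primal variables `(p, q, ω, θ̃)` of the planner's problem. -/
structure Primal where
  p : N → ℝ
  q : N → ℝ
  ω : N → ℝ
  θ : G.lines → ℝ

/-- Dual variables `(α, λ, η, ν)` of the planner's problem. -/
structure Dual where
  α : N → ℝ
  l : ℝ
  η : G.lines ⊕ G.lines → ℝ
  ν : N → ℝ

variable {G} in
/-- The objective `1ᵀ J(p) + ½ ωᵀ D ω`. -/
noncomputable def Primal.objective (P : G.Primal) : ℝ :=
  ∑ j, G.cost j (P.p j) + 1 / 2 * ∑ j, G.D j * P.ω j ^ 2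

variable {G} in
/-- Feasibility: `q = p`, `1ᵀ(q - d) = 0`, `Hᵀ(q - d) ≤ F`, `q - d - D ω - C B θ̃ = 0`. -/
structure Primal.Feasible (P : G.Primal) : Prop where
  dispatch : P.q = P.p
  balance : ∑ j, (P.q j - G.d j) = 0
  thermal : ∀ e, (G.Hᵀ *ᵥ (P.q - G.d)) e ≤ G.F e
  nodal : ∀ j, P.q j - G.d j - G.D j * P.ω j - ((G.C * diagonal G.B) *ᵥ P.θ) j = 0

variable {G} in
/-- The Lagrangian of the planner's problem. -/
noncomputable def lagrangian (P : G.Primal) (Y : G.Dual) : ℝ :=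
  P.objective
    + ∑ j, Y.ν j * (P.q j - G.d j - G.D j * P.ω j - ((G.C * diagonal G.B) *ᵥ P.θ) j)
    + ∑ j, Y.α j * (P.q j - P.p j)
    - Y.l * ∑ j, (P.q j - G.d j)
    + ∑ e, Y.η e * ((G.Hᵀ *ᵥ (P.q - G.d)) e - G.F e)

/-- `(P, Y)` is an optimal primal-dual solution of the planner's problem: `P` is a feasible
minimizer, the multipliers of the inequalities are nonnegative, and `(P, Y)` is a min-max saddle
point of the Lagrangian. -/
structure IsOptimalPrimalDual (P : G.Primal) (Y : G.Dual) : Prop where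
  feasible : P.Feasible
  minimal : ∀ P' : G.Primal, P'.Feasible → P.objective ≤ P'.objective
  nonneg : ∀ e, 0 ≤ Y.η e
  saddle_primal : ∀ P' : G.Primal, lagrangian P Y ≤ lagrangian P' Y
  saddle_dual : ∀ Y' : G.Dual, (∀ e, 0 ≤ Y'.η e) → lagrangian P Y' ≤ lagrangian P Y

/-! ### The regularized grid-market-participant loop -/

/-- States `((q̂, θ̃), (λ, ω, α, η))`, a finite-dimensional real normed space. -/
abbrev State : Type _ :=
  ((N → ℝ) × (G.lines → ℝ)) × (ℝ × (N → ℝ) × (N → ℝ) × (G.lines ⊕ G.lines → ℝ))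

section coordinates
variable {G}
/-- Virtual dispatch `q̂`. -/
def State.qhat (x : G.State) : N → ℝ := x.1.1
/-- Phase angle differences `θ̃`. -/
def State.θ (x : G.State) : G.lines → ℝ := x.1.2
/-- Multiplier `λ`. -/
def State.l (x : G.State) : ℝ := x.2.1
/-- Bus frequencies `ω`. -/
def State.ω (x : G.State) : N → ℝ := x.2.2.1
/-- Price bids `α`. -/
def State.α (x : G.State) : N → ℝ := x.2.2.2.1
/-- Multipliers `η`. -/
def State.η (x : G.State) : G.lines ⊕ G.lines → ℝ := x.2.2.2.2
end coordinates

/-- The clearing prices `π = λ 1 - H η - ω`. -/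
noncomputable def price (x : G.State) (j : N) : ℝ :=
  State.l x - (G.H *ᵥ State.η x) j - State.ω x j

/-- The real dispatch `q = (1/ρ) (λ 1 - H η - ω - α) + q̂`. -/
noncomputable def dispatch (ρ : ℝ) (x : G.State) (j : N) : ℝ :=
  1 / ρ * (G.price x j - State.α x j) + State.qhat x j

/-- The right-hand side of the closed loop, solved for the time derivatives
of `((q̂, θ̃), (λ, ω, α, η))`. -/
noncomputable def field (ρ : ℝ) (x : G.State) : G.State :=
  ((fun j => (G.price x j - State.α x j) / G.τq j,
    G.Cᵀ *ᵥ State.ω x),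
   (-(∑ j, (G.dispatch ρ x j - G.d j)) / G.τl,
    fun j => (G.dispatch ρ x j - G.d j - G.D j * State.ω x j
      - ((G.C * diagonal G.B) *ᵥ State.θ x) j) / G.M j,
    fun j => (G.dispatch ρ x j - G.invMarginalCost j (G.price x j)) / G.τα j,
    fun e => posProj ((G.Hᵀ *ᵥ (G.dispatch ρ x - G.d)) e - G.F e) (State.η x e) / G.τη e))

/-- Trajectories on `[0, ∞)` in the sense of Carathéodory: locally absolutely continuous
functions that satisfy the differential equation at almost every time. The values at negative
times are irrelevant. -/
structure IsTrajectory (ρ : ℝ) (x : ℝ → G.State) : Prop where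
  absolutelyContinuous : ∀ T : ℝ, 0 ≤ T → AbsolutelyContinuousOnInterval x 0 T
  ode : ∀ᵐ t ∂(volume.restrict (Set.Ici (0 : ℝ))), HasDerivAt x (G.field ρ (x t)) t

/-- The set `𝕀` of initial points. -/
def initialSet : Set G.State := {x | ∀ e, 0 ≤ State.η x e}

/-- The set `𝔼` of equilibrium points (in `𝕀`). -/
def equilibriumSet (ρ : ℝ) : Set G.State := {x | x ∈ G.initialSet ∧ G.field ρ x = 0}

/-- The primal variables of the planner's problem that correspond to a state, with
`p = (∇J)⁻¹(π)`. -/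
noncomputable def primalOf (ρ : ℝ) (x : G.State) : G.Primal where
  p := fun j => G.invMarginalCost j (G.price x j)
  q := G.dispatch ρ x
  ω := State.ω x
  θ := State.θ x

/-- The dual variables of the planner's problem that correspond to a state, with `ν = ω`. -/
def dualOf (x : G.State) : G.Dual where
  α := State.α x
  l := State.l x
  η := State.η x
  ν := State.ω x

end PowerMarket

/-- Global asymptotic stability on `I` of a set `E`, for the dynamics whose trajectories are given
by `Traj`: the set is Lyapunov stable, and every trajectory from `I` approaches it. -/
structure IsGloballyAsymptoticallyStableOn {X : Type*} [PseudoMetricSpace X]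
    (Traj : (ℝ → X) → Prop) (E I : Set X) : Prop where
  nonempty : E.Nonempty
  stable : ∀ ε > 0, ∃ δ > 0, ∀ x : ℝ → X, Traj x → x 0 ∈ I →
    Metric.infDist (x 0) E < δ → ∀ t ≥ 0, Metric.infDist (x t) E < ε
  attractive : ∀ x : ℝ → X, Traj x → x 0 ∈ I →
    Tendsto (fun t => Metric.infDist (x t) E) atTop (𝓝 0)

/-! The loop is a monotone system: in a suitable weighted inner product, any two trajectories from
`initialSet` never move apart. Write `dπ`, `dα`, `dω`, `dq` for differences between two states. With
weights `τq`, `B`, `τl`, `M`, `τα`, `τη`, the network coupling between `ω` and `θ̃` is skew and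
cancels, and the terms in `dq` combine through `π = λ1 - Hη - ω` (`weightedInner_sub_field_sub`).
What remains is `-D dω² - (1/ρ)(dπ² - (2 - ρ/c) dπ dα + dα²)`, plus the effect of projecting `η`.
The quadratic form is positive definite because `|2 - ρ/c| < 2`, which is where `0 < ρ < 4c` enters.
The projection adds a nonpositive term because it acts as a normal cone of the orthant. Comparison
with constant trajectories gives Lyapunov stability and boundedness.

Convergence is an invariance argument in which nonexpansiveness replaces continuity of the
discontinuous right-hand side. From a limit point of a trajectory `x`, start a new trajectory `y`.
Shifts of `x` converge to `y`, so the energy distance of `y` to a fixed equilibrium is constant. All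
dissipation along `y` therefore vanishes, which forces `y` to pass through an equilibrium
(`IsTrajectory.exists_mem_equilibriumSet`). Since `x` comes arbitrarily close to that point and
cannot drift away again, it converges to it.

Two existence results are needed. An equilibrium comes from minimizing the generation cost over
balanced dispatches within the thermal limits: KKT multipliers supply `λ` and `η`, connectivity
supplies `θ̃`, and `ω = 0`. Trajectories come from Skorokhod reflection: the projected equation is
solved by `x = w + ∑ e, l e • b e` with `w' = f(x)`, where `l e` is the running deficit of the
constrained coordinate of `w`, and a contraction in an exponentially weighted norm yields a global
solution (`exists_projected_solution`). Optimality of equilibria is the KKT theorem for a convex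
Lagrangian, carried out by completing squares. -/

/-! ### Absolutely continuous curves on the half-line -/

/-- A continuously differentiable function of an absolutely continuous curve is absolutely
continuous. -/
theorem AbsolutelyContinuousOnInterval.contDiff_comp {X : Type*} [NormedAddCommGroup X]
    [NormedSpace ℝ X] [ProperSpace X] {x : ℝ → X} {a b : ℝ}
    (hx : AbsolutelyContinuousOnInterval x a b) {V : X → ℝ} (hV : ContDiff ℝ 1 V) :
    AbsolutelyContinuousOnInterval (fun t => V (x t)) a b := by
  obtain ⟨R, hR⟩ := hx.exists_bound
  obtain ⟨K, hK⟩ := hV.contDiffOn.exists_lipschitzOnWith (s := Metric.closedBall (0 : X) R)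
    (by decide) (convex_closedBall _ _) (isCompact_closedBall _ _)
  rw [absolutelyContinuousOnInterval_iff] at hx ⊢
  intro ε hε
  -- `K + 1` replaces the Lipschitz constant `K`, which may be zero.
  obtain ⟨δ, hδ, h⟩ := hx (ε / (K + 1)) (by positivity)
  refine ⟨δ, hδ, fun E hE hEδ => ?_⟩
  have hmem : ∀ t ∈ Set.uIcc a b, x t ∈ Metric.closedBall (0 : X) R := fun t ht => by
    simpa using hR t ht
  have h1 : ∑ i ∈ Finset.range E.1, dist (V (x (E.2 i).1)) (V (x (E.2 i).2))
      ≤ K * ∑ i ∈ Finset.range E.1, dist (x (E.2 i).1) (x (E.2 i).2) := by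
    rw [Finset.mul_sum]
    refine Finset.sum_le_sum fun i hi => hK.dist_le_mul _ (hmem _ ?_) _ (hmem _ ?_)
    · exact (hE.1 i hi).1
    · exact (hE.1 i hi).2
  have h2 := h E hE hEδ
  have h3 : 0 ≤ ∑ i ∈ Finset.range E.1, dist (x (E.2 i).1) (x (E.2 i).2) :=
    Finset.sum_nonneg fun _ _ => dist_nonneg
  have h4 : (K + 1 : ℝ) * (ε / (K + 1)) = ε := by field_simp
  nlinarith [K.coe_nonneg]

/-- A locally absolutely continuous function on `[0, ∞)` with almost everywhere nonpositive
derivative is nonincreasing. -/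
theorem antitoneOn_of_ae_hasDerivAt_nonpos {g g' : ℝ → ℝ}
    (hg : ∀ T : ℝ, 0 ≤ T → AbsolutelyContinuousOnInterval g 0 T)
    (hd : ∀ᵐ t ∂(volume.restrict (Set.Ici (0 : ℝ))), HasDerivAt g (g' t) t ∧ g' t ≤ 0) :
    AntitoneOn g (Set.Ici 0) := by
  intro s hs t ht hst
  rw [Set.mem_Ici] at hs ht
  have hac : AbsolutelyContinuousOnInterval g s t := (hg t ht).mono (by
    rw [Set.uIcc_of_le hst, Set.uIcc_of_le ht]; exact Set.Icc_subset_Icc_left hs)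
  have h1 := hac.integral_deriv_eq_sub
  have h2 : ∫ u in s..t, deriv g u ≤ 0 := by
    rw [intervalIntegral.integral_of_le hst]
    apply integral_nonpos_of_ae
    have hsub : Set.Ioc s t ⊆ Set.Ici 0 := fun u hu => hs.trans hu.1.le
    filter_upwards [ae_restrict_of_ae_restrict_of_subset hsub hd] with u hu
    simpa [hu.1.deriv] using hu.2
  linarith

theorem ae_restrict_Ici_zero_pos : ∀ᵐ t ∂(volume.restrict (Set.Ici (0 : ℝ))), 0 < t := by
  rw [← Measure.restrict_congr_set (Ioi_ae_eq_Ici (a := (0 : ℝ)))]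
  exact ae_restrict_mem measurableSet_Ioi

/-- A property that holds almost everywhere on `[0, ∞)` holds at some positive time. -/
theorem exists_pos_of_ae_restrict_Ici {p : ℝ → Prop}
    (hp : ∀ᵐ t ∂(volume.restrict (Set.Ici (0 : ℝ))), p t) : ∃ t > 0, p t := by
  have : (ae (volume.restrict (Set.Ici (0 : ℝ)))).NeBot := by
    rw [ae_neBot, Ne, Measure.restrict_eq_zero]; simp
  obtain ⟨t, ht, h0⟩ := (hp.and ae_restrict_Ici_zero_pos).exists
  exact ⟨t, h0, ht⟩

/-- A function that is continuous on `[0, ∞)` and equal to `c` almost everywhere there equals `c`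
at all positive times. -/
theorem eq_of_ae_eq_of_continuousOn {Y : Type*} [TopologicalSpace Y] [T2Space Y] {f : ℝ → Y}
    {c : Y} (hf : ContinuousOn f (Set.Ici (0 : ℝ)))
    (hae : ∀ᵐ t ∂(volume.restrict (Set.Ici (0 : ℝ))), f t = c) : ∀ t > (0 : ℝ), f t = c := by
  have h1 : ∀ᵐ t ∂(volume.restrict (Set.Ioi (0 : ℝ))), f t = c :=
    ae_restrict_of_ae_restrict_of_subset Set.Ioi_subset_Ici_self hae
  have := Measure.eqOn_open_of_ae_eq (g := fun _ => c) h1 isOpen_Ioi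
    (hf.mono Set.Ioi_subset_Ici_self) continuousOn_const
  exact fun t ht => this ht

theorem AbsolutelyContinuousOnInterval.continuousOn_Ici {X : Type*} [NormedAddCommGroup X]
    {x : ℝ → X} (hx : ∀ T : ℝ, 0 ≤ T → AbsolutelyContinuousOnInterval x 0 T) :
    ContinuousOn x (Set.Ici (0 : ℝ)) := by
  intro t ht
  have ht0 : (0 : ℝ) ≤ t := ht
  have h1 : ContinuousOn x (Set.Icc 0 (t + 1)) := by
    have := (hx (t + 1) (by linarith)).continuousOn
    rwa [Set.uIcc_of_le (by linarith)] at this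
  have h2 : Set.Icc 0 (t + 1) ∈ 𝓝[Set.Ici 0] t := by
    rw [mem_nhdsWithin]
    exact ⟨Set.Iio (t + 1), isOpen_Iio, by simp, fun u hu => ⟨hu.2, le_of_lt hu.1⟩⟩
  exact (h1 t ⟨ht0, by linarith⟩).mono_of_mem_nhdsWithin h2

/-! ### One-dimensional Skorokhod reflection -/

/-- The largest amount by which `g` has been below zero on `[0, t]`: the regulator of the
one-dimensional Skorokhod reflection of `g` at zero. -/
noncomputable def runningDeficit (g : ℝ → ℝ) (t : ℝ) : ℝ :=
  sSup ((fun s => max 0 (-(g (s * t)))) '' Set.Icc (0 : ℝ) 1)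

section runningDeficit

variable {g h : ℝ → ℝ} {s t C : ℝ}

theorem bddAbove_runningDeficit (hg : Continuous g) (t : ℝ) :
    BddAbove ((fun s => max 0 (-(g (s * t)))) '' Set.Icc (0 : ℝ) 1) :=
  (isCompact_Icc.image (by fun_prop)).bddAbove

theorem neg_le_runningDeficit (hg : Continuous g) (hs : 0 ≤ s) (hst : s ≤ t) :
    -(g s) ≤ runningDeficit g t := by
  rcases hs.eq_or_lt with rfl | hs'
  · refine le_csSup_of_le (bddAbove_runningDeficit hg t)
      (Set.mem_image_of_mem _ (Set.left_mem_Icc.2 zero_le_one)) ?_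
    simp
  · have ht : 0 < t := hs'.trans_le hst
    refine le_csSup_of_le (bddAbove_runningDeficit hg t)
      (Set.mem_image_of_mem _ (⟨div_nonneg hs ht.le, (div_le_one ht).2 hst⟩ :
        s / t ∈ Set.Icc (0 : ℝ) 1)) ?_
    simp [div_mul_cancel₀ s ht.ne']

theorem runningDeficit_nonneg (hg : Continuous g) (t : ℝ) : 0 ≤ runningDeficit g t :=
  le_csSup_of_le (bddAbove_runningDeficit hg t)
    (Set.mem_image_of_mem _ (Set.left_mem_Icc.2 zero_le_one)) (le_max_left _ _)

theorem runningDeficit_le (ht : 0 ≤ t) (hC : 0 ≤ C) (h : ∀ s, 0 ≤ s → s ≤ t → -(g s) ≤ C) :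
    runningDeficit g t ≤ C := by
  refine csSup_le ((Set.nonempty_Icc.2 zero_le_one).image _) ?_
  rintro _ ⟨s, hs, rfl⟩
  exact max_le hC (h _ (mul_nonneg hs.1 ht) (mul_le_of_le_one_left ht hs.2))

/-- The supremum runs over the fixed compact interval `[0, 1]` thanks to the rescaling `s * t`, so
joint continuity of the integrand-like expression in `(t, s)` suffices. -/
theorem continuous_runningDeficit (hg : Continuous g) : Continuous (runningDeficit g) :=
  isCompact_Icc.continuous_sSup (f := fun t s => max 0 (-(g (s * t))))
    (by simp only [Function.HasUncurry.uncurry]; fun_prop)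

theorem monotoneOn_runningDeficit (hg : Continuous g) :
    MonotoneOn (runningDeficit g) (Set.Ici 0) := fun _ hs t _ hst =>
  runningDeficit_le hs (runningDeficit_nonneg hg t) fun _ h0 h1 =>
    neg_le_runningDeficit hg h0 (h1.trans hst)

theorem runningDeficit_zero (h0 : 0 ≤ g 0) : runningDeficit g 0 = 0 := by
  have : (fun s : ℝ => max 0 (-(g (s * 0)))) = fun _ => 0 := by
    funext s
    simpa using h0
  rw [runningDeficit, this, (Set.nonempty_Icc.2 zero_le_one).image_const, csSup_singleton]

/-- The regulator is nonexpansive for the supremum norm on `[0, t]`; this is what makes reflection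
compatible with a Picard iteration. -/
theorem abs_runningDeficit_sub_le (hg : Continuous g) (hh : Continuous h) (ht : 0 ≤ t)
    (hC : 0 ≤ C) (hgh : ∀ s, 0 ≤ s → s ≤ t → |g s - h s| ≤ C) :
    |runningDeficit g t - runningDeficit h t| ≤ C := by
  have h1 : runningDeficit g t ≤ runningDeficit h t + C :=
    runningDeficit_le ht (add_nonneg (runningDeficit_nonneg hh t) hC) fun s h0 hs => by
      linarith [neg_le_runningDeficit hh h0 hs, (abs_le.1 (hgh s h0 hs)).1]
  have h2 : runningDeficit h t ≤ runningDeficit g t + C :=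
    runningDeficit_le ht (add_nonneg (runningDeficit_nonneg hg t) hC) fun s h0 hs => by
      linarith [neg_le_runningDeficit hg h0 hs, (abs_le.1 (hgh s h0 hs)).2]
  exact abs_le.2 ⟨by linarith, by linarith⟩

/-- A deficit reached before time `s` is already counted at `s`, and one reached later exceeds `-(g
s)` by at most `K` times the elapsed time. This is the source of the absolute continuity of
reflected solutions. -/
theorem lipschitzOnWith_runningDeficit {K : NNReal} {T : ℝ} (hg : Continuous g)
    (hK : LipschitzOnWith K g (Set.Icc 0 T)) :
    LipschitzOnWith K (runningDeficit g) (Set.Icc 0 T) := by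
  refine LipschitzOnWith.of_le_add_mul K fun t ht s hs => ?_
  refine runningDeficit_le ht.1
    (add_nonneg (runningDeficit_nonneg hg s) (mul_nonneg K.2 dist_nonneg)) fun u h0 hu => ?_
  rcases le_total u s with hus | hsu
  · have := neg_le_runningDeficit hg h0 hus
    have h2 : 0 ≤ K * dist t s := mul_nonneg K.2 dist_nonneg
    linarith
  · have h1 := hK.dist_le_mul u ⟨h0, hu.trans ht.2⟩ s hs
    have h2 := neg_le_runningDeficit hg hs.1 le_rfl
    rw [Real.dist_eq, Real.dist_eq, abs_of_nonneg (sub_nonneg.2 hsu)] at h1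
    rw [Real.dist_eq, abs_of_nonneg (by linarith)]
    have h3 : (K : ℝ) * (u - s) ≤ K * (t - s) :=
      mul_le_mul_of_nonneg_left (by linarith) K.2
    linarith [(abs_le.1 h1).1]

/-- The regulator is locally constant while the reflected path is positive. -/
theorem runningDeficit_eventuallyEq (hg : Continuous g) (ht : 0 < t)
    (hpos : 0 < g t + runningDeficit g t) :
    ∀ᶠ s in 𝓝 t, runningDeficit g s = runningDeficit g t := by
  set m := runningDeficit g t
  -- The midpoint between `-(g t)` and the current maximum `m`. Near `t` the path `-g` stays below
  -- `c`, so the maximum is neither raised nor attained there.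
  set c := (m - g t) / 2
  have hc : -(g t) < c := by simp only [c]; linarith
  have hcm : c < m := by simp only [c]; linarith
  have hev : ∀ᶠ s in 𝓝 t, -(g s) < c := hg.neg.continuousAt.eventually_lt_const hc
  obtain ⟨ε, hε, hball⟩ := Metric.eventually_nhds_iff.1 hev
  filter_upwards [Metric.ball_mem_nhds t hε, lt_mem_nhds ht] with s hs hs0
  rw [Metric.mem_ball, Real.dist_eq, abs_lt] at hs
  rcases le_total t s with hts | hst
  · refine le_antisymm (runningDeficit_le hs0.le (runningDeficit_nonneg hg t) fun u h0 hu => ?_)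
      (monotoneOn_runningDeficit hg ht.le hs0.le hts)
    rcases le_total u t with h | h
    · exact neg_le_runningDeficit hg h0 h
    · refine ((hball ?_).trans hcm).le
      rw [Real.dist_eq, abs_lt]
      constructor <;> linarith
  · refine le_antisymm (monotoneOn_runningDeficit hg hs0.le ht.le hst) ?_
    have h1 : m ≤ max (runningDeficit g s) c := by
      refine runningDeficit_le ht.le (le_max_of_le_left (runningDeficit_nonneg hg s))
        fun u h0 hu => ?_
      rcases le_total u s with h | h
      · exact le_max_of_le_left (neg_le_runningDeficit hg h0 h)
      · refine le_max_of_le_right (hball ?_).le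
        rw [Real.dist_eq, abs_lt]
        constructor <;> linarith
    exact (le_max_iff.1 h1).resolve_right hcm.not_ge

end runningDeficit

/-! ### Reflection in several coordinates -/

section reflect

variable {X κ : Type*} [NormedAddCommGroup X] [NormedSpace ℝ X] [Fintype κ]

/-- Reflection of the path `w` at the hyperplanes `φ e = 0` along the directions `b e`. -/
noncomputable def reflect (φ : κ → X →L[ℝ] ℝ) (b : κ → X) (w : ℝ → X) (t : ℝ) : X :=
  w t + ∑ e, runningDeficit (fun s => φ e (w s)) t • b e

variable {φ : κ → X →L[ℝ] ℝ} {b : κ → X} {w w' : ℝ → X} {t : ℝ}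

theorem continuous_reflect (hw : Continuous w) : Continuous (reflect φ b w) := by
  refine hw.add (continuous_finsetSum _ fun e _ => ?_)
  exact (continuous_runningDeficit ((φ e).continuous.comp hw)).smul continuous_const

/-- The constant depends neither on time nor on the paths, so the weight `K` in the fixed-point
argument can be chosen once for the whole half-line. -/
theorem norm_reflect_sub_le (hw : Continuous w) (hw' : Continuous w') (ht : 0 ≤ t) {C : ℝ}
    (hC : 0 ≤ C) (h : ∀ s, 0 ≤ s → s ≤ t → ‖w s - w' s‖ ≤ C) :
    ‖reflect φ b w t - reflect φ b w' t‖ ≤ (1 + ∑ e, ‖φ e‖ * ‖b e‖) * C := by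
  have h1 : reflect φ b w t - reflect φ b w' t = (w t - w' t) + ∑ e,
      (runningDeficit (fun s => φ e (w s)) t - runningDeficit (fun s => φ e (w' s)) t) • b e := by
    simp only [reflect, sub_smul, Finset.sum_sub_distrib]
    abel
  rw [h1, add_mul, one_mul, Finset.sum_mul]
  refine (norm_add_le _ _).trans (add_le_add (h t ht le_rfl) ((norm_sum_le _ _).trans
    (Finset.sum_le_sum fun e _ => ?_)))
  rw [norm_smul, Real.norm_eq_abs]
  have h2 : |runningDeficit (fun s => φ e (w s)) t - runningDeficit (fun s => φ e (w' s)) t|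
      ≤ ‖φ e‖ * C := by
    refine abs_runningDeficit_sub_le ((φ e).continuous.comp hw) ((φ e).continuous.comp hw') ht
      (mul_nonneg (norm_nonneg _) hC) fun s h0 hs => ?_
    rw [← map_sub, ← Real.norm_eq_abs]
    exact ((φ e).le_opNorm _).trans (mul_le_mul_of_nonneg_left (h s h0 hs) (norm_nonneg _))
  calc _ ≤ ‖φ e‖ * C * ‖b e‖ := mul_le_mul_of_nonneg_right h2 (norm_nonneg _)
    _ = _ := by ring

theorem lipschitzOnWith_reflect {K : NNReal} {T : ℝ} (hw : Continuous w)
    (hK : LipschitzOnWith K w (Set.Icc 0 T)) :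
    ∃ K', LipschitzOnWith K' (reflect φ b w) (Set.Icc 0 T) := by
  have h1 : ∀ e, LipschitzOnWith (‖φ e‖₊ * K) (fun s => φ e (w s)) (Set.Icc 0 T) := fun e =>
    (φ e).lipschitz.comp_lipschitzOnWith hK
  refine ⟨K + ∑ e, ‖φ e‖₊ * K * ‖b e‖₊, LipschitzOnWith.of_dist_le_mul fun s hs t ht => ?_⟩
  have h2 : reflect φ b w s - reflect φ b w t = (w s - w t) + ∑ e,
      (runningDeficit (fun s => φ e (w s)) s - runningDeficit (fun s => φ e (w s)) t) • b e := by
    simp only [reflect, sub_smul, Finset.sum_sub_distrib]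
    abel
  rw [dist_eq_norm, h2]
  push_cast
  rw [add_mul, Finset.sum_mul]
  refine (norm_add_le _ _).trans (add_le_add ?_ ((norm_sum_le _ _).trans
    (Finset.sum_le_sum fun e _ => ?_)))
  · rw [← dist_eq_norm]; exact hK.dist_le_mul s hs t ht
  · rw [norm_smul, ← dist_eq_norm]
    have := (lipschitzOnWith_runningDeficit ((φ e).continuous.comp hw) (h1 e)).dist_le_mul
      s hs t ht
    calc _ ≤ (‖φ e‖₊ * K : NNReal) * dist s t * ‖b e‖ :=
          mul_le_mul_of_nonneg_right this (norm_nonneg _)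
      _ = _ := by push_cast; ring

end reflect

/-! ### Global existence for projected differential equations -/

section picard

variable {X κ : Type*} [NormedAddCommGroup X] [NormedSpace ℝ X] [CompleteSpace X] [Fintype κ]

/-- The integral curve `x₀ + ∫₀ᵗ f (exp (K s) u(s)) ds`, where `u` is a curve in exponentially
rescaled coordinates. -/
noncomputable def rescaledIntegral (f : X → X) (K : ℝ) (x₀ : X) (u : ℝ → X) (t : ℝ) : X :=
  x₀ + ∫ s in (0 : ℝ)..t, f (Real.exp (K * s) • u s)

variable {f : X → X} {L : NNReal} {K : ℝ} {x₀ : X} {u v : ℝ → X}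

theorem hasDerivAt_rescaledIntegral (hf : Continuous f) (hu : Continuous u) (t : ℝ) :
    HasDerivAt (rescaledIntegral f K x₀ u) (f (Real.exp (K * t) • u t)) t := by
  have hc : Continuous fun s => f (Real.exp (K * s) • u s) := by fun_prop
  exact (hc.integral_hasStrictDerivAt 0 t).hasDerivAt.const_add x₀

theorem continuous_rescaledIntegral (hf : Continuous f) (hu : Continuous u) :
    Continuous (rescaledIntegral f K x₀ u) :=
  continuous_iff_continuousAt.2 fun t => (hasDerivAt_rescaledIntegral hf hu t).continuousAt

/-- Integrating `L * D * exp (K s)` gains a factor `1 / K`. Hence a large `K` makes the integral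
operator contract on the whole half-line in the exponentially weighted norm. -/
theorem norm_rescaledIntegral_sub_le (hf : LipschitzWith L f) (hK : 0 < K) (hu : Continuous u)
    (hv : Continuous v) {D : ℝ} (hD : 0 ≤ D) (huv : ∀ s, ‖u s - v s‖ ≤ D) {t : ℝ} (ht : 0 ≤ t) :
    ‖rescaledIntegral f K x₀ u t - rescaledIntegral f K x₀ v t‖
      ≤ L * D / K * Real.exp (K * t) := by
  have hB : ∀ s, HasDerivAt (fun s => L * D / K * Real.exp (K * s))
      (L * D * Real.exp (K * s)) s := fun s => by
    have := ((hasDerivAt_id s).const_mul K).exp.const_mul (L * D / K)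
    refine this.congr_deriv ?_
    simp only [id]
    field_simp
  refine image_norm_le_of_norm_deriv_right_le_deriv_boundary
    (f := fun t => rescaledIntegral f K x₀ u t - rescaledIntegral f K x₀ v t) (a := 0) (b := t)
    ((continuous_rescaledIntegral hf.continuous hu).sub
      (continuous_rescaledIntegral hf.continuous hv)).continuousOn
    (fun s _ => ((hasDerivAt_rescaledIntegral hf.continuous hu s).sub
      (hasDerivAt_rescaledIntegral hf.continuous hv s)).hasDerivWithinAt)
    (B := fun s => L * D / K * Real.exp (K * s)) ?_ hB (fun s _ => ?_) ⟨ht, le_rfl⟩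
  · simp only [rescaledIntegral, intervalIntegral.integral_same, sub_self, norm_zero]
    positivity
  · rw [← dist_eq_norm]
    refine (hf.dist_le_mul _ _).trans ?_
    rw [dist_eq_norm, ← smul_sub, norm_smul, Real.norm_eq_abs, Real.abs_exp]
    have := huv s
    have h1 : 0 ≤ (L : ℝ) * Real.exp (K * s) := by positivity
    nlinarith

variable (φ : κ → X →L[ℝ] ℝ) (b : κ → X)

/-- For a Lipschitz map `f`, the reflected integral equation has a global solution. -/
theorem exists_eq_reflect_integral (hf : LipschitzWith L f) (x₀ : X) :
    ∃ x w : ℝ → X, ContinuousOn x (Set.Ici 0) ∧ Continuous w ∧ w 0 = x₀ ∧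
      (∀ t ≥ 0, HasDerivAt w (f (x t)) t) ∧ ∀ t ≥ 0, x t = reflect φ b w t := by
  set c : ℝ := 1 + ∑ e, ‖φ e‖ * ‖b e‖
  have hc : 1 ≤ c := le_add_of_nonneg_right
    (Finset.sum_nonneg fun _ _ => mul_nonneg (norm_nonneg _) (norm_nonneg _))
  -- Chosen so that `c * L / K ≤ 1 / 2`; the summand `1` keeps `K ≥ 1` even if `L = 0`.
  set K : ℝ := 2 * c * L + 1
  have hK1 : 1 ≤ K := le_add_of_nonneg_left (by positivity)
  have hK : 0 < K := by linarith
  -- Evaluation at `|t|` extends the operator to curves on all of `ℝ`, so that the complete space of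
  -- bounded continuous functions is available.
  set Φ : (ℝ → X) → ℝ → X := fun u t =>
    Real.exp (-(K * |t|)) • reflect φ b (rescaledIntegral f K x₀ u) |t| with hΦ
  have hΦc : ∀ u, Continuous u → Continuous (Φ u) := fun u hu => by
    have := (continuous_reflect (φ := φ) (b := b)
      (continuous_rescaledIntegral (K := K) (x₀ := x₀) hf.continuous hu)).comp continuous_abs
    exact (by fun_prop : Continuous fun t : ℝ => Real.exp (-(K * |t|))).smul this
  have hexp : ∀ t : ℝ, Real.exp (-(K * |t|)) * Real.exp (K * |t|) = 1 := fun t => by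
    rw [← Real.exp_add]; simp
  have hcontr : ∀ u v, Continuous u → Continuous v → ∀ D, 0 ≤ D → (∀ s, ‖u s - v s‖ ≤ D) →
      ∀ t, ‖Φ u t - Φ v t‖ ≤ 1 / 2 * D := fun u v hu hv D hD huv t => by
    have h1 : ‖reflect φ b (rescaledIntegral f K x₀ u) |t|
        - reflect φ b (rescaledIntegral f K x₀ v) |t|‖ ≤ c * (L * D / K * Real.exp (K * |t|)) := by
      refine norm_reflect_sub_le (continuous_rescaledIntegral hf.continuous hu)
        (continuous_rescaledIntegral hf.continuous hv) (abs_nonneg t) (by positivity)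
        fun s h0 hs => (norm_rescaledIntegral_sub_le hf hK hu hv hD huv h0).trans ?_
      refine mul_le_mul_of_nonneg_left (Real.exp_le_exp.2 ?_) (by positivity)
      exact mul_le_mul_of_nonneg_left hs hK.le
    simp only [hΦ]
    rw [← smul_sub, norm_smul, Real.norm_eq_abs, Real.abs_exp]
    refine (mul_le_mul_of_nonneg_left h1 (Real.exp_pos _).le).trans ?_
    have h2 : Real.exp (-(K * |t|)) * (c * (L * D / K * Real.exp (K * |t|))) = c * L / K * D := by
      linear_combination (c * (L * D / K)) * hexp t
    rw [h2]
    refine mul_le_mul_of_nonneg_right ?_ hD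
    rw [div_le_iff₀ hK]
    simp only [K]
    linarith
  -- A single bounded image together with the contraction estimate shows that the operator preserves
  -- bounded functions.
  have h0 : ∃ C, ∀ t, ‖Φ (fun _ => 0) t‖ ≤ C := by
    refine ⟨c * (‖x₀‖ + ‖f 0‖), fun t => ?_⟩
    have hw : ∀ s, rescaledIntegral f K x₀ (fun _ => 0) s = x₀ + s • f 0 := fun s => by
      simp [rescaledIntegral]
    have hr : reflect φ b (fun _ => (0 : X)) |t| = 0 := by
      have : ∀ t, runningDeficit (fun _ => 0) t = 0 := fun t => by
        rw [runningDeficit]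
        simp [(Set.nonempty_Icc.2 (zero_le_one (α := ℝ))).image_const]
      simp [reflect, this]
    have h1 := norm_reflect_sub_le (φ := φ) (b := b) (w := rescaledIntegral f K x₀ (fun _ => 0))
      (w' := fun _ => 0) (continuous_rescaledIntegral hf.continuous continuous_const)
      continuous_const (abs_nonneg t) (C := ‖x₀‖ + |t| * ‖f 0‖) (by positivity) (fun s hs0 hs => by
        rw [hw, sub_zero]
        refine (norm_add_le _ _).trans (add_le_add le_rfl ?_)
        rw [norm_smul, Real.norm_eq_abs, abs_of_nonneg hs0]
        exact mul_le_mul_of_nonneg_right hs (norm_nonneg _))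
    rw [hr, sub_zero] at h1
    simp only [hΦ]
    rw [norm_smul, Real.norm_eq_abs, Real.abs_exp]
    refine (mul_le_mul_of_nonneg_left h1 (Real.exp_pos _).le).trans ?_
    have h2 : Real.exp (-(K * |t|)) ≤ 1 := by
      rw [Real.exp_le_one_iff]; have := abs_nonneg t; nlinarith
    have h3 : Real.exp (-(K * |t|)) * |t| ≤ 1 := by
      have h4 : |t| ≤ Real.exp (K * |t|) := by
        have := Real.add_one_le_exp (K * |t|)
        nlinarith [abs_nonneg t]
      calc _ ≤ Real.exp (-(K * |t|)) * Real.exp (K * |t|) :=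
            mul_le_mul_of_nonneg_left h4 (Real.exp_pos _).le
        _ = 1 := hexp t
    have h4 : Real.exp (-(K * |t|)) * (‖x₀‖ + |t| * ‖f 0‖) ≤ ‖x₀‖ + ‖f 0‖ := by
      nlinarith [norm_nonneg x₀, norm_nonneg (f 0)]
    change _ * (c * _) ≤ _
    nlinarith
  obtain ⟨C, hC⟩ := h0
  have hbd : ∀ u : BoundedContinuousFunction ℝ X, ∀ t, ‖Φ u t‖ ≤ 1 / 2 * ‖u‖ + C := fun u t => by
    have h1 := hcontr u (fun _ => 0) u.continuous continuous_const ‖u‖ (norm_nonneg _)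
      (fun s => by simpa using u.norm_coe_le_norm s) t
    have h2 := norm_add_le (Φ u t - Φ (fun _ => 0) t) (Φ (fun _ => 0) t)
    rw [sub_add_cancel] at h2
    linarith [hC t]
  let Ψ : BoundedContinuousFunction ℝ X → BoundedContinuousFunction ℝ X := fun u =>
    BoundedContinuousFunction.ofNormedAddCommGroup (Φ u) (hΦc u u.continuous) _ (hbd u)
  have hΨ : ContractingWith (1 / 2 : NNReal) Ψ := by
    refine ⟨by rw [div_lt_one] <;> norm_num, LipschitzWith.of_dist_le_mul fun u v => ?_⟩
    rw [BoundedContinuousFunction.dist_le (by positivity)]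
    intro t
    rw [dist_eq_norm]
    exact (hcontr u v u.continuous v.continuous (dist u v) dist_nonneg
      (fun s => by rw [← dist_eq_norm]; exact BoundedContinuousFunction.dist_coe_le_dist s)
      t).trans_eq (by simp)
  set u := hΨ.fixedPoint Ψ
  have hfix : ∀ t, u t = Φ u t := fun t =>
    (DFunLike.congr_fun hΨ.fixedPoint_isFixedPt t).symm
  set w := rescaledIntegral f K x₀ u
  have hwc : Continuous w := continuous_rescaledIntegral hf.continuous u.continuous
  have hu : ∀ t ≥ 0, Real.exp (K * t) • u t = reflect φ b w t := fun t ht => by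
    rw [hfix t]
    simp only [hΦ]
    rw [abs_of_nonneg ht, smul_smul, ← Real.exp_add]
    simp [w]
  refine ⟨reflect φ b w, w, (continuous_reflect hwc).continuousOn, hwc, by
    simp [w, rescaledIntegral], fun t ht => ?_, fun t _ => rfl⟩
  rw [← hu t ht]
  exact hasDerivAt_rescaledIntegral hf.continuous u.continuous t

/-- Global existence for the projected differential equation on the orthant `φ e ≥ 0`, where the
constraint `φ e` is enforced along the direction `b e`. -/
theorem exists_projected_solution {φ : κ → X →L[ℝ] ℝ} {b : κ → X} [DecidableEq κ]
    (hφ : ∀ e e', φ e (b e') = if e = e' then 1 else 0) (hf : LipschitzWith L f)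
    (h₀ : ∀ e, 0 ≤ φ e x₀) :
    ∃ x : ℝ → X, x 0 = x₀ ∧ (∀ T : ℝ, 0 ≤ T → AbsolutelyContinuousOnInterval x 0 T) ∧
      ∀ᵐ t ∂(volume.restrict (Set.Ici (0 : ℝ))), HasDerivAt x (f (x t) +
        ∑ e, (posProj (φ e (f (x t))) (φ e (x t)) - φ e (f (x t))) • b e) t := by
  obtain ⟨x, w, hxc, hwc, hw0, hwd, hx⟩ := exists_eq_reflect_integral φ b hf x₀
  have hgc : ∀ e, Continuous fun s => φ e (w s) := fun e => (φ e).continuous.comp hwc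
  set l : κ → ℝ → ℝ := fun e => runningDeficit fun s => φ e (w s) with hl
  have hφx : ∀ e, ∀ t ≥ 0, φ e (x t) = φ e (w t) + l e t := fun e t ht => by
    rw [hx t ht, reflect]
    simp [hφ, hl]
  have hφx0 : ∀ e, ∀ t ≥ 0, 0 ≤ φ e (x t) := fun e t ht => by
    rw [hφx e t ht]
    linarith [neg_le_runningDeficit (hgc e) ht le_rfl]
  refine ⟨x, ?_, fun T hT => ?_, ?_⟩
  · rw [hx 0 le_rfl, reflect, hw0]
    have : ∀ e, runningDeficit (fun s => φ e (w s)) 0 = 0 := fun e =>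
      runningDeficit_zero (by simpa [hw0] using h₀ e)
    simp [this]
  · obtain ⟨A, hA⟩ := (isCompact_Icc (a := (0 : ℝ)) (b := T)).exists_bound_of_continuousOn
      ((hf.continuous.comp_continuousOn hxc).mono (Set.Icc_subset_Ici_self))
    have hwL : LipschitzOnWith A.toNNReal w (Set.Icc 0 T) := by
      refine LipschitzOnWith.of_dist_le_mul fun s hs t ht => ?_
      wlog hst : s ≤ t generalizing s t
      · rw [dist_comm, dist_comm s t]; exact this t ht s hs (le_of_not_ge hst)
      have := norm_image_sub_le_of_norm_deriv_le_segment' (f := w) (f' := fun r => f (x r))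
        (C := A) (fun r hr => (hwd r (hs.1.trans hr.1)).hasDerivWithinAt)
        (fun r hr => hA r ⟨hs.1.trans hr.1, hr.2.le.trans ht.2⟩) t ⟨hst, le_rfl⟩
      rw [dist_comm, dist_eq_norm, dist_comm, Real.dist_eq, abs_of_nonneg (by linarith)]
      exact this.trans (mul_le_mul_of_nonneg_right (Real.le_coe_toNNReal A) (by linarith))
    obtain ⟨K', hK'⟩ := lipschitzOnWith_reflect (φ := φ) (b := b) hwc hwL
    refine LipschitzOnWith.absolutelyContinuousOnInterval (K := K') ?_
    rw [Set.uIcc_of_le hT]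
    intro s hs t ht
    rw [hx s hs.1, hx t ht.1]
    exact hK' hs ht
  · have hdiff : ∀ e, ∀ᵐ t ∂(volume.restrict (Set.Ici (0 : ℝ))),
        DifferentiableWithinAt ℝ (l e) (Set.Ici 0) t := fun e =>
      (monotoneOn_runningDeficit (hgc e)).ae_differentiableWithinAt measurableSet_Ici
    filter_upwards [eventually_countable_forall.2 hdiff, ae_restrict_Ici_zero_pos] with t hd ht
    have hnhds : Set.Ici 0 ∈ 𝓝 t := Ici_mem_nhds ht
    have hld : ∀ e, HasDerivAt (l e) (deriv (l e) t) t := fun e =>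
      ((hd e).differentiableAt hnhds).hasDerivAt
    have hxd : HasDerivAt x (f (x t) + ∑ e, deriv (l e) t • b e) t := by
      have h1 := (hwd t ht.le).add (HasDerivAt.fun_sum (u := Finset.univ)
        fun e _ => (hld e).smul_const (b e))
      refine h1.congr_of_eventuallyEq ?_
      filter_upwards [hnhds] with s hs
      rw [hx s hs]
      rfl
    convert hxd using 5 with e
    have hr0 : 0 ≤ deriv (l e) t := by
      rw [← (hld e).hasDerivWithinAt.derivWithin (uniqueDiffWithinAt_of_mem_nhds hnhds)]
      exact (monotoneOn_runningDeficit (hgc e)).derivWithin_nonneg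
    rcases (hφx0 e t ht.le).eq_or_lt with h0 | hpos
    -- On the boundary the constraint function is at a minimum in time, so its derivative vanishes.
    -- The regulator must then cancel the drift exactly, and since its rate is nonnegative, the
    -- drift is nonpositive.
    · have hmin : IsLocalMin (fun s => φ e (x s)) t := by
        filter_upwards [hnhds] with s hs
        rw [← h0]
        exact hφx0 e s hs
      have h1 := hmin.hasDerivAt_eq_zero ((φ e).hasFDerivAt.comp_hasDerivAt t hxd)
      simp only [map_add, map_sum, map_smul, hφ, smul_eq_mul, mul_ite, mul_one, mul_zero,
        Finset.sum_ite_eq, Finset.mem_univ, if_true] at h1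
      rw [posProj, if_neg]
      · linarith
      · rw [← h0]; rintro (h | h) <;> linarith
    · have h1 := runningDeficit_eventuallyEq (hgc e) ht (by rw [← hφx e t ht.le]; exact hpos)
      have h2 : deriv (l e) t = 0 := by
        rw [EventuallyEq.deriv_eq (f := fun _ => l e t) h1, deriv_const]
      rw [h2, posProj, if_pos (Or.inr hpos), sub_self]

end picard

/-! ### Farkas' lemma and first-order optimality conditions -/

/-- Farkas' lemma for finitely many linear functionals on a real vector space. -/
theorem exists_nonneg_sum_smul_eq_of_forall_nonpos {X κ : Type*} [AddCommGroup X] [Module ℝ X]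
    (s : Finset κ) (a : κ → X →ₗ[ℝ] ℝ) (b : X →ₗ[ℝ] ℝ)
    (h : ∀ x, (∀ i ∈ s, a i x ≤ 0) → b x ≤ 0) :
    ∃ η : κ → ℝ, (∀ i, 0 ≤ η i) ∧ b = ∑ i ∈ s, η i • a i := by
  classical
  induction s using Finset.induction_on generalizing a b with
  | empty =>
    refine ⟨0, fun _ => le_rfl, LinearMap.ext fun x => ?_⟩
    have h1 := h x (by simp)
    have h2 := h (-x) (by simp)
    rw [map_neg] at h2
    simpa using le_antisymm h1 (by linarith)
  | insert k s hk ih =>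
    by_cases hs : ∀ x, (∀ i ∈ s, a i x ≤ 0) → b x ≤ 0
    · obtain ⟨η, hη, rfl⟩ := ih a b hs
      refine ⟨fun i => if i = k then 0 else η i, fun i => ?_, ?_⟩
      · dsimp only; split_ifs; exacts [le_rfl, hη i]
      · simp only [Finset.sum_insert hk, if_true, zero_smul, zero_add]
        refine Finset.sum_congr rfl fun i hi => ?_
        rw [if_neg (ne_of_mem_of_not_mem hi hk)]
    · push Not at hs
      obtain ⟨z, hz, hbz⟩ := hs
      have hkz : 0 < a k z := by
        by_contra hcon
        refine hbz.not_ge (h z fun i hi => ?_)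
        rcases Finset.mem_insert.1 hi with rfl | hi
        exacts [not_lt.1 hcon, hz i hi]
      -- Subtracting multiples of `a k` makes all functionals vanish at `z`. Moving `x` along `z`
      -- into the kernel of `a k` then reduces the hypothesis to the functionals in `s`.
      obtain ⟨η, hη, hb⟩ := ih (fun i => a i - (a i z / a k z) • a k) (b - (b z / a k z) • a k)
        fun x hx => by
          have h1 := h (x - (a k x / a k z) • z) fun i hi => by
            rcases Finset.mem_insert.1 hi with rfl | hi
            · simp [hkz.ne']
            · have := hx i hi
              simp only [LinearMap.sub_apply, LinearMap.smul_apply, smul_eq_mul, map_sub,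
                map_smul] at this ⊢
              calc _ = a i x - a i z / a k z * a k x := by ring
                _ ≤ 0 := this
          simp only [LinearMap.sub_apply, LinearMap.smul_apply, smul_eq_mul, map_sub,
            map_smul] at h1 ⊢
          calc _ = b x - a k x / a k z * b z := by ring
            _ ≤ 0 := h1
      -- The coefficient of `a k` after undoing the subtraction; its sign follows from `a i z ≤ 0 <
      -- b z`.
      set r : ℝ := b z / a k z - ∑ i ∈ s, η i * (a i z / a k z)
      have hr : 0 ≤ r := by
        have h1 : ∑ i ∈ s, η i * (a i z / a k z) ≤ 0 := Finset.sum_nonpos fun i hi =>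
          mul_nonpos_of_nonneg_of_nonpos (hη i) (div_nonpos_of_nonpos_of_nonneg (hz i hi) hkz.le)
        have h2 : 0 < b z / a k z := div_pos hbz hkz
        simp only [r]
        linarith
      refine ⟨fun i => if i = k then r else η i, fun i => ?_, ?_⟩
      · dsimp only; split_ifs; exacts [hr, hη i]
      · simp only [Finset.sum_insert hk, if_true]
        have h1 : ∑ i ∈ s, (if i = k then r else η i) • a i = ∑ i ∈ s, η i • a i :=
          Finset.sum_congr rfl fun i hi => by rw [if_neg (ne_of_mem_of_not_mem hi hk)]
        rw [h1, ← sub_eq_zero]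
        rw [← sub_eq_zero] at hb
        simp only [smul_sub, Finset.sum_sub_distrib, smul_smul, ← Finset.sum_smul] at hb
        have hrk : r • a k = (b z / a k z) • a k - (∑ i ∈ s, η i * (a i z / a k z)) • a k :=
          sub_smul (b z / a k z) (∑ i ∈ s, η i * (a i z / a k z)) (a k)
        rw [hrk, ← hb]
        abel

/-- First-order optimality conditions of Karush, Kuhn and Tucker for a minimum on a polyhedron. -/
theorem exists_kkt_multipliers {X κ : Type*} [NormedAddCommGroup X] [NormedSpace ℝ X] [Fintype κ]
    {f : X → ℝ} {f' : X →L[ℝ] ℝ} {x : X} {a : κ → X →L[ℝ] ℝ} {β : κ → ℝ}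
    (hx : ∀ i, a i x ≤ β i) (hf : HasFDerivAt f f' x)
    (hmin : ∀ y, (∀ i, a i y ≤ β i) → f x ≤ f y) :
    ∃ η : κ → ℝ, (∀ i, 0 ≤ η i) ∧ (∀ i, η i * (a i x - β i) = 0) ∧
      ∀ v, f' v + ∑ i, η i * a i v = 0 := by
  classical
  set S : Set X := {y | ∀ i, a i y ≤ β i} with hS
  have hconv : Convex ℝ S := by
    have : S = ⋂ i, {y | a i y ≤ β i} := by ext; simp [hS]
    rw [this]
    exact convex_iInter fun i => convex_halfSpace_le (a i).isLinear (β i)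
  set s : Finset κ := Finset.univ.filter fun i => a i x = β i with hs
  -- A direction that does not increase any active constraint stays feasible for a short step, so
  -- `f'` is nonnegative along it. Farkas' lemma applies to `-f'` and the active constraints.
  obtain ⟨η, hη, hb⟩ := exists_nonneg_sum_smul_eq_of_forall_nonpos s
    (fun i => (a i : X →ₗ[ℝ] ℝ)) (-(f' : X →ₗ[ℝ] ℝ)) fun v hv => by
      have hev : ∀ᶠ ε in 𝓝[>] (0 : ℝ), ∀ i, a i (x + ε • v) ≤ β i := by
        refine eventually_all.2 fun i => ?_
        rcases (hx i).eq_or_lt with hi | hi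
        · filter_upwards [self_mem_nhdsWithin] with ε hε
          have h1 : a i v ≤ 0 := hv i (by simp [hs, hi])
          have h2 : 0 < ε := hε
          rw [map_add, map_smul, smul_eq_mul, hi]
          nlinarith
        · have : ContinuousAt (fun ε : ℝ => a i (x + ε • v)) 0 := by fun_prop
          have := Tendsto.eventually_lt_const (u := β i) (by simpa using hi) this.tendsto
          exact (this.filter_mono nhdsWithin_le_nhds).mono fun _ h => h.le
      obtain ⟨ε, hε, hε0⟩ := (hev.and self_mem_nhdsWithin).exists
      have h1 : IsLocalMinOn f S x := IsMinOn.localize fun y hy => hmin y hy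
      have h2 := h1.hasFDerivWithinAt_nonneg hf.hasFDerivWithinAt
        (mem_posTangentConeAt_of_segment_subset (y := ε • v)
          (hconv.segment_subset hx hε))
      rw [map_smul, smul_eq_mul] at h2
      have h3 := nonneg_of_mul_nonneg_right h2 hε0
      simpa using h3
  refine ⟨fun i => if i ∈ s then η i else 0, fun i => ?_, fun i => ?_, fun v => ?_⟩
  · dsimp only; split_ifs; exacts [hη i, le_rfl]
  · by_cases hi : a i x = β i
    · simp [hi]
    · simp [hs, hi]
  · have h1 := LinearMap.congr_fun hb v
    simp only [LinearMap.neg_apply, LinearMap.sum_apply, LinearMap.smul_apply, smul_eq_mul,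
      ContinuousLinearMap.coe_coe] at h1
    simp only [ite_mul, zero_mul, Finset.sum_ite_mem, Finset.univ_inter]
    linarith

/-! ### The weighted energy and its equivalence with the norm -/

/-- A continuous positive definite function that is homogeneous of degree two is comparable to the
square of the norm. -/
theorem exists_norm_sq_bounds {X : Type*} [NormedAddCommGroup X] [NormedSpace ℝ X]
    [FiniteDimensional ℝ X] {V : X → ℝ} (hV : Continuous V)
    (hhom : ∀ (c : ℝ) x, V (c • x) = c ^ 2 * V x) (hpos : ∀ x, x ≠ 0 → 0 < V x) :
    ∃ m > 0, ∃ M > 0, ∀ x, m * ‖x‖ ^ 2 ≤ V x ∧ V x ≤ M * ‖x‖ ^ 2 := by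
  have h0 : V 0 = 0 := by simpa using hhom 0 0
  rcases subsingleton_or_nontrivial X with hX | hX
  · refine ⟨1, one_pos, 1, one_pos, fun x => ?_⟩
    rw [Subsingleton.elim x 0]
    simp [h0]
  · have := FiniteDimensional.proper_real X
    have hc : IsCompact (Metric.sphere (0 : X) 1) := isCompact_sphere 0 1
    have hne : (Metric.sphere (0 : X) 1).Nonempty := NormedSpace.sphere_nonempty.2 zero_le_one
    obtain ⟨y, hy, hmin⟩ := hc.exists_isMinOn hne hV.continuousOn
    obtain ⟨z, hz, hmax⟩ := hc.exists_isMaxOn hne hV.continuousOn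
    have hne0 : ∀ y ∈ Metric.sphere (0 : X) 1, y ≠ 0 := fun y hy => by
      rintro rfl; simp at hy
    refine ⟨V y, hpos y (hne0 y hy), V z, hpos z (hne0 z hz), fun x => ?_⟩
    by_cases hx : x = 0
    · simp [hx, h0]
    · have hx' : ‖x‖ ≠ 0 := norm_ne_zero_iff.2 hx
      have hmem : ‖x‖⁻¹ • x ∈ Metric.sphere (0 : X) 1 := by
        simp [norm_smul, hx']
      have h1 : V x = ‖x‖ ^ 2 * V (‖x‖⁻¹ • x) := by
        rw [← hhom, smul_inv_smul₀ hx']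
      have h2 : V y ≤ V (‖x‖⁻¹ • x) := hmin hmem
      have h3 : V (‖x‖⁻¹ • x) ≤ V z := hmax hmem
      rw [h1]
      constructor <;> nlinarith [sq_nonneg ‖x‖]

namespace PowerMarket

section energy

variable {N : Type*} [Fintype N] [DecidableEq N] (G : PowerMarket N)

/-- The violation `Hᵀ (q - d) - F` of the thermal limits. -/
noncomputable def congestion (ρ : ℝ) (x : G.State) (e : G.lines ⊕ G.lines) : ℝ :=
  (G.Hᵀ *ᵥ (G.dispatch ρ x - G.d)) e - G.F e

/-- The inner product on the states that is weighted by the time constants, the inertia and the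
line sensitivities. -/
def weightedInner (x y : G.State) : ℝ :=
  ∑ j, G.τq j * (State.qhat x j * State.qhat y j) + ∑ e, G.B e * (State.θ x e * State.θ y e)
    + G.τl * (State.l x * State.l y) + ∑ j, G.M j * (State.ω x j * State.ω y j)
    + ∑ j, G.τα j * (State.α x j * State.α y j) + ∑ e, G.τη e * (State.η x e * State.η y e)

/-- The squared weighted norm. -/
def energy (x : G.State) : ℝ := G.weightedInner x x

theorem contDiff_energy : ContDiff ℝ 1 G.energy := by
  unfold energy weightedInner State.qhat State.θ State.l State.ω State.α State.η
  fun_prop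

theorem energy_smul (c : ℝ) (x : G.State) : G.energy (c • x) = c ^ 2 * G.energy x := by
  simp only [energy, weightedInner, State.qhat, State.θ, State.l, State.ω, State.α, State.η,
    Prod.smul_fst, Prod.smul_snd, Pi.smul_apply, smul_eq_mul, mul_add, Finset.mul_sum]
  congr 1; congr 1; congr 1; congr 1; congr 1
  all_goals first
    | ring1
    | exact Finset.sum_congr rfl fun _ _ => by ring

theorem energy_pos {x : G.State} (hx : x ≠ 0) : 0 < G.energy x := by
  have h1 : ∀ j, 0 ≤ G.τq j * (State.qhat x j * State.qhat x j) := fun j =>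
    mul_nonneg (G.τq_pos j).le (mul_self_nonneg _)
  have h2 : ∀ e, 0 ≤ G.B e * (State.θ x e * State.θ x e) := fun e =>
    mul_nonneg (G.B_pos e).le (mul_self_nonneg _)
  have h3 : 0 ≤ G.τl * (State.l x * State.l x) := mul_nonneg G.τl_pos.le (mul_self_nonneg _)
  have h4 : ∀ j, 0 ≤ G.M j * (State.ω x j * State.ω x j) := fun j =>
    mul_nonneg (G.M_pos j).le (mul_self_nonneg _)
  have h5 : ∀ j, 0 ≤ G.τα j * (State.α x j * State.α x j) := fun j =>
    mul_nonneg (G.τα_pos j).le (mul_self_nonneg _)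
  have h6 : ∀ e, 0 ≤ G.τη e * (State.η x e * State.η x e) := fun e =>
    mul_nonneg (G.τη_pos e).le (mul_self_nonneg _)
  have s1 := Finset.sum_nonneg fun j (_ : j ∈ Finset.univ) => h1 j
  have s2 := Finset.sum_nonneg fun j (_ : j ∈ Finset.univ) => h2 j
  have s4 := Finset.sum_nonneg fun j (_ : j ∈ Finset.univ) => h4 j
  have s5 := Finset.sum_nonneg fun j (_ : j ∈ Finset.univ) => h5 j
  have s6 := Finset.sum_nonneg fun j (_ : j ∈ Finset.univ) => h6 j
  by_contra hcon
  simp only [energy, weightedInner] at hcon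
  have e1 := (Finset.sum_eq_zero_iff_of_nonneg fun j _ => h1 j).1
    (le_antisymm (by linarith) s1)
  have e2 := (Finset.sum_eq_zero_iff_of_nonneg fun j _ => h2 j).1
    (le_antisymm (by linarith) s2)
  have e3 : G.τl * (State.l x * State.l x) = 0 := le_antisymm (by linarith) h3
  have e4 := (Finset.sum_eq_zero_iff_of_nonneg fun j _ => h4 j).1
    (le_antisymm (by linarith) s4)
  have e5 := (Finset.sum_eq_zero_iff_of_nonneg fun j _ => h5 j).1
    (le_antisymm (by linarith) s5)
  have e6 := (Finset.sum_eq_zero_iff_of_nonneg fun j _ => h6 j).1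
    (le_antisymm (by linarith) s6)
  refine hx (Prod.ext (Prod.ext (funext fun j => ?_) (funext fun e => ?_))
    (Prod.ext ?_ (Prod.ext (funext fun j => ?_) (Prod.ext (funext fun j => ?_)
      (funext fun e => ?_)))))
  · simpa [(G.τq_pos j).ne', State.qhat] using e1 j (Finset.mem_univ j)
  · simpa [(G.B_pos e).ne', State.θ] using e2 e (Finset.mem_univ e)
  · simpa [G.τl_pos.ne', State.l] using e3
  · simpa [(G.M_pos j).ne', State.ω] using e4 j (Finset.mem_univ j)
  · simpa [(G.τα_pos j).ne', State.α] using e5 j (Finset.mem_univ j)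
  · simpa [(G.τη_pos e).ne', State.η] using e6 e (Finset.mem_univ e)

theorem exists_energy_bounds :
    ∃ m > 0, ∃ M > 0, ∀ x : G.State, m * ‖x‖ ^ 2 ≤ G.energy x ∧ G.energy x ≤ M * ‖x‖ ^ 2 :=
  exists_norm_sq_bounds G.contDiff_energy.continuous G.energy_smul fun _ => G.energy_pos

variable {G} in
theorem hasDerivAt_linearMap_comp {z : ℝ → G.State} {z' : G.State} {t : ℝ}
    (hz : HasDerivAt z z' t) (φ : G.State →ₗ[ℝ] ℝ) : HasDerivAt (fun s => φ (z s)) (φ z') t :=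
  φ.toContinuousLinearMap.hasFDerivAt.comp_hasDerivAt t hz

theorem hasDerivAt_energy {z : ℝ → G.State} {z' : G.State} {t : ℝ} (hz : HasDerivAt z z' t) :
    HasDerivAt (fun s => G.energy (z s)) (2 * G.weightedInner (z t) z') t := by
  have hlin : ∀ φ : G.State →ₗ[ℝ] ℝ, HasDerivAt (fun s => φ (z s)) (φ z') t :=
    hasDerivAt_linearMap_comp hz
  have hq : ∀ j, HasDerivAt (fun s => State.qhat (z s) j) (State.qhat z' j) t := fun j =>
    hlin ⟨⟨fun x => State.qhat x j, fun _ _ => rfl⟩, fun _ _ => rfl⟩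
  have hθ : ∀ j, HasDerivAt (fun s => State.θ (z s) j) (State.θ z' j) t := fun j =>
    hlin ⟨⟨fun x => State.θ x j, fun _ _ => rfl⟩, fun _ _ => rfl⟩
  have hl : HasDerivAt (fun s => State.l (z s)) (State.l z') t :=
    hlin ⟨⟨fun x => State.l x, fun _ _ => rfl⟩, fun _ _ => rfl⟩
  have hω : ∀ j, HasDerivAt (fun s => State.ω (z s) j) (State.ω z' j) t := fun j =>
    hlin ⟨⟨fun x => State.ω x j, fun _ _ => rfl⟩, fun _ _ => rfl⟩
  have hα : ∀ j, HasDerivAt (fun s => State.α (z s) j) (State.α z' j) t := fun j =>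
    hlin ⟨⟨fun x => State.α x j, fun _ _ => rfl⟩, fun _ _ => rfl⟩
  have hη : ∀ j, HasDerivAt (fun s => State.η (z s) j) (State.η z' j) t := fun j =>
    hlin ⟨⟨fun x => State.η x j, fun _ _ => rfl⟩, fun _ _ => rfl⟩
  have h := (((((HasDerivAt.fun_sum (u := Finset.univ)
      fun j _ => ((hq j).mul (hq j)).const_mul (G.τq j)).add
    (HasDerivAt.fun_sum (u := Finset.univ)
      fun e _ => ((hθ e).mul (hθ e)).const_mul (G.B e))).add
    ((hl.mul hl).const_mul G.τl)).add (HasDerivAt.fun_sum (u := Finset.univ)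
      fun j _ => ((hω j).mul (hω j)).const_mul (G.M j))).add
    (HasDerivAt.fun_sum (u := Finset.univ)
      fun j _ => ((hα j).mul (hα j)).const_mul (G.τα j))).add
    (HasDerivAt.fun_sum (u := Finset.univ)
      fun e _ => ((hη e).mul (hη e)).const_mul (G.τη e))
  refine h.congr_deriv ?_
  simp only [weightedInner, mul_add, Finset.mul_sum]
  congr 1; congr 1; congr 1; congr 1; congr 1
  all_goals first
    | ring1
    | exact Finset.sum_congr rfl fun _ _ => by ring

end energy

/-! ### Monotonicity of the vector field -/

section dissipation

variable {N : Type*} [Fintype N] [DecidableEq N] (G : PowerMarket N)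

/-- The weight `B` on `θ̃` is chosen for this identity: it cancels the exchange between phase angles
and frequencies in the energy balance. -/
theorem sum_B_mul_transpose_C (ω : N → ℝ) (θ : G.lines → ℝ) :
    ∑ e, G.B e * (θ e * (G.Cᵀ *ᵥ ω) e) = ∑ j, ω j * ((G.C * diagonal G.B) *ᵥ θ) j := by
  have h1 : ∑ j, ω j * ((G.C * diagonal G.B) *ᵥ θ) j = (G.Cᵀ *ᵥ ω) ⬝ᵥ (diagonal G.B *ᵥ θ) := by
    rw [← mulVec_mulVec, mulVec_transpose, ← dotProduct_mulVec]
    rfl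
  rw [h1]
  refine Finset.sum_congr rfl fun e _ => ?_
  rw [mulVec_diagonal]
  ring

theorem sum_mul_transpose_H (η : G.lines ⊕ G.lines → ℝ) (v : N → ℝ) :
    ∑ e, η e * (G.Hᵀ *ᵥ v) e = ∑ j, v j * (G.H *ᵥ η) j := by
  have h1 : ∑ j, v j * (G.H *ᵥ η) j = v ⬝ᵥ (G.H *ᵥ η) := rfl
  rw [h1, dotProduct_mulVec, ← mulVec_transpose, dotProduct_comm]
  rfl

/-- The rate at which the weighted distance of two unconstrained trajectories decreases. -/
noncomputable def dissipation (ρ : ℝ) (x y : G.State) : ℝ :=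
  ∑ j, (G.D j * (State.ω x j - State.ω y j) ^ 2 + 1 / ρ *
    ((G.price x j - G.price y j) ^ 2
      - (2 - ρ / G.c j) * ((G.price x j - G.price y j) * (State.α x j - State.α y j))
      + (State.α x j - State.α y j) ^ 2))

/-- Without the projection, the terms in `dq` sum to `-dq (dπ - dα)`, up to `-dα dπ / c`. Since `dq
= (dπ - dα) / ρ + dq̂`, the `q̂` equation cancels the part with `dq̂` and leaves `-(dπ - dα)² / ρ`.
The last sum collects the projection corrections. -/
theorem weightedInner_sub_field_sub {ρ : ℝ} (hρ : 0 < ρ) (x y : G.State) :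
    G.weightedInner (x - y) (G.field ρ x - G.field ρ y) = -G.dissipation ρ x y
      + ∑ e, (State.η x e - State.η y e) *
        ((posProj (G.congestion ρ x e) (State.η x e) - G.congestion ρ x e)
          - (posProj (G.congestion ρ y e) (State.η y e) - G.congestion ρ y e)) := by
  set dω : N → ℝ := State.ω x - State.ω y with hdω
  set dθ : G.lines → ℝ := State.θ x - State.θ y with hdθ
  set dη : G.lines ⊕ G.lines → ℝ := State.η x - State.η y with hdη
  set du : N → ℝ := G.dispatch ρ x - G.dispatch ρ y with hdu
  have hdη' : ∀ e, State.η x e - State.η y e = dη e := fun e => rfl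
  have hcong : ∀ e, G.congestion ρ x e - G.congestion ρ y e = (G.Hᵀ *ᵥ du) e := fun e => by
    have : du = (G.dispatch ρ x - G.d) - (G.dispatch ρ y - G.d) := by rw [hdu]; abel
    rw [this, mulVec_sub, Pi.sub_apply, congestion, congestion]
    ring
  have hH : ∀ j, (G.H *ᵥ State.η x) j - (G.H *ᵥ State.η y) j = (G.H *ᵥ dη) j := fun j => by
    rw [hdη, mulVec_sub, Pi.sub_apply]
  have hθ : ∀ j, ((G.C * diagonal G.B) *ᵥ State.θ x) j - ((G.C * diagonal G.B) *ᵥ State.θ y) j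
      = ((G.C * diagonal G.B) *ᵥ dθ) j := fun j => by
    rw [hdθ, mulVec_sub, Pi.sub_apply]
  have hω : ∀ e, (G.Cᵀ *ᵥ State.ω x) e - (G.Cᵀ *ᵥ State.ω y) e = (G.Cᵀ *ᵥ dω) e := fun e => by
    rw [hdω, mulVec_sub, Pi.sub_apply]
  have hA1 := G.sum_B_mul_transpose_C dω dθ
  have hA2 := G.sum_mul_transpose_H dη du
  have t1 : ∀ j, G.τq j * (State.qhat (x - y) j * State.qhat (G.field ρ x - G.field ρ y) j)
      = (State.qhat x j - State.qhat y j) * ((G.price x j - State.α x j)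
        - (G.price y j - State.α y j)) := fun j => by
    have := (G.τq_pos j).ne'
    simp only [State.qhat, field, Prod.fst_sub, Pi.sub_apply]
    field_simp
  have t2 : ∀ e, G.B e * (State.θ (x - y) e * State.θ (G.field ρ x - G.field ρ y) e)
      = G.B e * (dθ e * (G.Cᵀ *ᵥ dω) e) := fun e => by
    rw [← hω]; rfl
  have t3 : G.τl * (State.l (x - y) * State.l (G.field ρ x - G.field ρ y))
      = ∑ j, -((State.l x - State.l y) * du j) := by
    have := G.τl_pos.ne'
    simp only [State.l, field, Prod.fst_sub, Prod.snd_sub, hdu, Pi.sub_apply, ← Finset.mul_sum,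
      Finset.sum_sub_distrib, Finset.sum_neg_distrib]
    field_simp
    ring
  have t4 : ∀ j, G.M j * (State.ω (x - y) j * State.ω (G.field ρ x - G.field ρ y) j)
      = dω j * (du j - G.D j * dω j) - dω j * ((G.C * diagonal G.B) *ᵥ dθ) j := fun j => by
    have := (G.M_pos j).ne'
    rw [← hθ]
    simp only [State.ω, field, Prod.fst_sub, Prod.snd_sub, hdu, hdω, Pi.sub_apply]
    field_simp
    ring
  have t5 : ∀ j, G.τα j * (State.α (x - y) j * State.α (G.field ρ x - G.field ρ y) j)
      = (State.α x j - State.α y j) * (du j - (G.price x j - G.price y j) / G.c j) := fun j => by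
    have := (G.τα_pos j).ne'
    have := (G.c_pos j).ne'
    simp only [State.α, field, Prod.fst_sub, Prod.snd_sub, hdu, Pi.sub_apply, invMarginalCost]
    field_simp
    ring
  have t6 : ∀ e, G.τη e * (State.η (x - y) e * State.η (G.field ρ x - G.field ρ y) e)
      = dη e * (posProj (G.congestion ρ x e) (State.η x e)
        - posProj (G.congestion ρ y e) (State.η y e)) := fun e => by
    have := (G.τη_pos e).ne'
    simp only [State.η, field, Prod.snd_sub, hdη, Pi.sub_apply, congestion]
    field_simp
  have t7 : ∀ e, (State.η x e - State.η y e) *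
        ((posProj (G.congestion ρ x e) (State.η x e) - G.congestion ρ x e)
          - (posProj (G.congestion ρ y e) (State.η y e) - G.congestion ρ y e))
      = dη e * (posProj (G.congestion ρ x e) (State.η x e)
        - posProj (G.congestion ρ y e) (State.η y e)) - dη e * (G.Hᵀ *ᵥ du) e := fun e => by
    rw [hdη', ← hcong]; ring
  simp only [weightedInner, t1, t2, t3, t4, t5, t6, t7, Finset.sum_sub_distrib, hA1, hA2]
  have key : ∑ j, (State.qhat x j - State.qhat y j) * ((G.price x j - State.α x j)
        - (G.price y j - State.α y j)) + ∑ j, -((State.l x - State.l y) * du j)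
      + ∑ j, dω j * (du j - G.D j * dω j)
      + ∑ j, (State.α x j - State.α y j) * (du j - (G.price x j - G.price y j) / G.c j)
      = -G.dissipation ρ x y - ∑ j, du j * (G.H *ᵥ dη) j := by
    rw [dissipation, ← Finset.sum_neg_distrib, ← Finset.sum_add_distrib, ← Finset.sum_add_distrib,
      ← Finset.sum_add_distrib, ← Finset.sum_sub_distrib]
    refine Finset.sum_congr rfl fun j _ => ?_
    have := (G.c_pos j).ne'
    rw [← hH]
    simp only [hdu, hdω, Pi.sub_apply, dispatch, price]
    field_simp
    ring
  linarith

theorem posProj_sub_nonneg {y u : ℝ} : 0 ≤ posProj y u - y ∧ (0 < u → posProj y u - y = 0) := by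
  unfold posProj
  split_ifs with h
  · simp
  · push Not at h
    exact ⟨by linarith, fun hu => absurd hu h.2.not_gt⟩

/-- The correction `posProj y u - y` is nonnegative and vanishes for `u > 0`, so it is the negative
of a normal vector to `[0, ∞)` at `u`, and normal cones of convex sets are monotone. -/
theorem sub_mul_posProj_sub_nonpos {y u y' u' : ℝ} (hu : 0 ≤ u) (hu' : 0 ≤ u') :
    (u - u') * ((posProj y u - y) - (posProj y' u' - y')) ≤ 0 := by
  obtain ⟨h1, h2⟩ := posProj_sub_nonneg (y := y) (u := u)
  obtain ⟨h3, h4⟩ := posProj_sub_nonneg (y := y') (u := u')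
  rcases hu.eq_or_lt with rfl | hu <;> rcases hu'.eq_or_lt with rfl | hu'
  · simp
  · rw [h4 hu']; nlinarith
  · rw [h2 hu]; nlinarith
  · rw [h2 hu, h4 hu']; simp

/-- Positive definiteness of the quadratic form in the price and bid deviations. -/
theorem quadratic_nonneg {ρ c a b : ℝ} (hρ : 0 < ρ) (hc : 0 < c) (hρc : ρ < 4 * c) :
    0 ≤ a ^ 2 - (2 - ρ / c) * (a * b) + b ^ 2 ∧
      (a ^ 2 - (2 - ρ / c) * (a * b) + b ^ 2 = 0 → a = 0 ∧ b = 0) := by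
  set k := ρ / c
  have hk0 : 0 < k := div_pos hρ hc
  have hk4 : k < 4 := by rw [div_lt_iff₀ hc]; exact hρc
  -- In the variables `a - b` and `a + b` the form is diagonal, with both weights positive exactly
  -- for `0 < k < 4`.
  have hid : a ^ 2 - (2 - k) * (a * b) + b ^ 2
      = (1 - k / 4) * (a - b) ^ 2 + k / 4 * (a + b) ^ 2 := by ring
  rw [hid]
  have h1 : 0 ≤ (1 - k / 4) * (a - b) ^ 2 := mul_nonneg (by linarith) (sq_nonneg _)
  have h2 : 0 ≤ k / 4 * (a + b) ^ 2 := mul_nonneg (by linarith) (sq_nonneg _)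
  refine ⟨by linarith, fun h => ?_⟩
  have h3 : (1 - k / 4) * (a - b) ^ 2 = 0 := by linarith
  have h4 : k / 4 * (a + b) ^ 2 = 0 := by linarith
  have h5 : a - b = 0 := by
    rcases mul_eq_zero.1 h3 with h | h
    · linarith
    · exact pow_eq_zero_iff two_ne_zero |>.1 h
  have h6 : a + b = 0 := by
    rcases mul_eq_zero.1 h4 with h | h
    · linarith
    · exact pow_eq_zero_iff two_ne_zero |>.1 h
  constructor <;> linarith

variable {G} {ρ : ℝ}

theorem dissipation_term_nonneg (hρ : 0 < ρ) (hρc : ∀ j, ρ < 4 * G.c j) (x y : G.State) (j : N) :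
    0 ≤ G.D j * (State.ω x j - State.ω y j) ^ 2 ∧ 0 ≤ 1 / ρ *
    ((G.price x j - G.price y j) ^ 2
      - (2 - ρ / G.c j) * ((G.price x j - G.price y j) * (State.α x j - State.α y j))
      + (State.α x j - State.α y j) ^ 2) :=
  ⟨mul_nonneg (G.D_pos j).le (sq_nonneg _), mul_nonneg (by positivity)
    (quadratic_nonneg hρ (G.c_pos j) (hρc j)).1⟩

theorem dissipation_nonneg (hρ : 0 < ρ) (hρc : ∀ j, ρ < 4 * G.c j) (x y : G.State) :
    0 ≤ G.dissipation ρ x y := Finset.sum_nonneg fun j _ =>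
  add_nonneg (dissipation_term_nonneg hρ hρc x y j).1 (dissipation_term_nonneg hρ hρc x y j).2

theorem eq_of_dissipation_eq_zero (hρ : 0 < ρ) (hρc : ∀ j, ρ < 4 * G.c j) {x y : G.State}
    (h : G.dissipation ρ x y = 0) (j : N) :
    State.ω x j = State.ω y j ∧ G.price x j = G.price y j ∧ State.α x j = State.α y j := by
  have h1 := (Finset.sum_eq_zero_iff_of_nonneg fun j _ => add_nonneg
    (dissipation_term_nonneg hρ hρc x y j).1 (dissipation_term_nonneg hρ hρc x y j).2).1 h j
    (Finset.mem_univ j)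
  obtain ⟨h2, h3⟩ := dissipation_term_nonneg hρ hρc x y j
  have h4 : G.D j * (State.ω x j - State.ω y j) ^ 2 = 0 := by linarith
  have h5 := (mul_eq_zero.1 (show 1 / ρ *
    ((G.price x j - G.price y j) ^ 2
      - (2 - ρ / G.c j) * ((G.price x j - G.price y j) * (State.α x j - State.α y j))
      + (State.α x j - State.α y j) ^ 2) = 0 by linarith)).resolve_left (by positivity)
  have h6 := (quadratic_nonneg hρ (G.c_pos j) (hρc j)).2 h5
  have h7 := pow_eq_zero_iff two_ne_zero |>.1 ((mul_eq_zero.1 h4).resolve_left (G.D_pos j).ne')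
  exact ⟨sub_eq_zero.1 h7, sub_eq_zero.1 h6.1, sub_eq_zero.1 h6.2⟩

theorem weightedInner_field_nonpos (hρ : 0 < ρ) (hρc : ∀ j, ρ < 4 * G.c j) {x y : G.State}
    (hx : x ∈ G.initialSet) (hy : y ∈ G.initialSet) :
    G.weightedInner (x - y) (G.field ρ x - G.field ρ y) ≤ 0 := by
  rw [G.weightedInner_sub_field_sub hρ]
  have h1 := dissipation_nonneg hρ hρc x y
  have h2 := Finset.sum_nonpos fun e (_ : e ∈ Finset.univ) =>
    sub_mul_posProj_sub_nonpos (y := G.congestion ρ x e) (y' := G.congestion ρ y e) (hx e) (hy e)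
  linarith

end dissipation

end PowerMarket

/-! ### Equilibria and the planner's problem -/

theorem posProj_eq_zero_iff {y u : ℝ} (hu : 0 ≤ u) : posProj y u = 0 ↔ y ≤ 0 ∧ u * y = 0 := by
  unfold posProj
  split_ifs with h
  · refine ⟨fun hy => by simp [hy], fun ⟨h1, h2⟩ => ?_⟩
    rcases h with h | h
    · linarith
    · exact (mul_eq_zero.1 h2).resolve_left h.ne'
  · push Not at h
    simp [h.1, le_antisymm h.2 hu]

namespace PowerMarket

section equilibrium

variable {N : Type*} [Fintype N] [DecidableEq N] (G : PowerMarket N)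

theorem transpose_C_mulVec (ω : N → ℝ) (e : G.lines) :
    (G.Cᵀ *ᵥ ω) e = ω (e : N × N).1 - ω (e : N × N).2 := by
  have hne : (e : N × N).1 ≠ (e : N × N).2 := fun h => by
    have h1 : ((e : N × N).1, (e : N × N).2) ∈ G.lines := e.2
    have h2 := G.oriented _ _ h1
    rw [h] at h1 h2
    exact h2 h1
  have h : ∀ j, G.C j e * ω j = (if (e : N × N).1 = j then ω j else 0)
      - (if (e : N × N).2 = j then ω j else 0) := fun j => by
    simp only [C, Matrix.of_apply]
    split_ifs with h1 h2
    · exact absurd (h1.trans h2.symm) hne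
    all_goals ring
  simp only [mulVec, dotProduct, transpose_apply, h, Finset.sum_sub_distrib, Finset.sum_ite_eq,
    Finset.mem_univ, if_true]

theorem sum_C_mul_diagonal_mulVec (θ : G.lines → ℝ) :
    ∑ j, ((G.C * diagonal G.B) *ᵥ θ) j = 0 := by
  have h := G.sum_B_mul_transpose_C (fun _ => 1) θ
  simp only [transpose_C_mulVec, sub_self, mul_zero, Finset.sum_const_zero, one_mul] at h
  exact h.symm

/-- On a connected network, a vector without differences along the lines is constant. -/
theorem eq_of_transpose_C_mulVec_eq_zero {ω : N → ℝ} (h : ∀ e, (G.Cᵀ *ᵥ ω) e = 0) (i j : N) :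
    ω i = ω j := by
  obtain ⟨p⟩ := G.connected.preconnected i j
  induction p with
  | nil => rfl
  | cons hadj _ ih =>
    rw [← ih]
    obtain ⟨-, hl | hl⟩ := (SimpleGraph.fromRel_adj _ _ _).1 hadj
    · have := h ⟨_, hl⟩
      rw [transpose_C_mulVec] at this
      exact sub_eq_zero.1 this
    · have := h ⟨_, hl⟩
      rw [transpose_C_mulVec] at this
      exact (sub_eq_zero.1 this).symm

/-- On a connected network, every balanced injection is produced by some line flow of the form
`C B θ`. -/
theorem exists_C_mul_diagonal_mulVec_eq {v : N → ℝ} (hv : ∑ j, v j = 0) :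
    ∃ θ, (G.C * diagonal G.B) *ᵥ θ = v := by
  set P := moorePenroseInverse G.laplacian
  have hP := G.isMoorePenroseInverse_laplacian
  refine ⟨G.Cᵀ *ᵥ (P *ᵥ v), ?_⟩
  have h1 : (G.C * diagonal G.B) *ᵥ (G.Cᵀ *ᵥ (P *ᵥ v)) = (G.laplacian * P) *ᵥ v := by
    simp only [laplacian, mulVec_mulVec, Matrix.mul_assoc]
  -- The residual lies in the kernel of the Laplacian. The quadratic form of the Laplacian then
  -- shows that it has no differences along lines, so it is constant; as its entries sum to zero, it
  -- vanishes.
  set r := v - (G.laplacian * P) *ᵥ v with hr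
  have hLP : G.laplacian * (G.laplacian * P) = G.laplacian := by
    have h2 := congrArg transpose hP.mul_mul_self
    rwa [transpose_mul, hP.symm_left, G.laplacian_symm] at h2
  have hLr : G.laplacian *ᵥ r = 0 := by
    rw [hr, mulVec_sub, mulVec_mulVec, hLP, sub_self]
  have h3 := G.sum_B_mul_transpose_C r (G.Cᵀ *ᵥ r)
  have h4 : (G.C * diagonal G.B) *ᵥ (G.Cᵀ *ᵥ r) = 0 := by
    rw [mulVec_mulVec, ← hLr, laplacian]
  simp only [h4, Pi.zero_apply, mul_zero, Finset.sum_const_zero] at h3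
  have h5 : ∀ e, (G.Cᵀ *ᵥ r) e = 0 := fun e => by
    have := (Finset.sum_eq_zero_iff_of_nonneg fun e _ =>
      mul_nonneg (G.B_pos e).le (mul_self_nonneg _)).1 h3 e (Finset.mem_univ e)
    simpa [(G.B_pos e).ne'] using this
  have h6 : ∑ j, r j = 0 := by
    simp only [hr, Pi.sub_apply, Finset.sum_sub_distrib, hv, ← h1, sum_C_mul_diagonal_mulVec,
      sub_self]
  have h7 : r = 0 := by
    have := G.connected.nonempty
    funext i
    have h8 : ∑ j, r j = Fintype.card N * r i := by
      rw [Finset.sum_congr rfl fun j _ => G.eq_of_transpose_C_mulVec_eq_zero h5 j i]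
      simp
    rw [h6, eq_comm, mul_eq_zero] at h8
    exact h8.resolve_left (by exact_mod_cast Fintype.card_ne_zero)
  rw [h1]
  exact (sub_eq_zero.1 h7).symm

theorem price_eq_iff_eq_invMarginalCost {j : N} {q y : ℝ} :
    q = G.invMarginalCost j y ↔ y = G.c j * q + G.cbar j := by
  rw [invMarginalCost, eq_div_iff (G.c_pos j).ne']
  constructor <;> intro h <;> linarith

/-- The equations that characterize equilibria. -/
theorem mem_equilibriumSet_iff {ρ : ℝ} {x : G.State} :
    x ∈ G.equilibriumSet ρ ↔ (∀ e, 0 ≤ State.η x e) ∧ (∀ j, G.price x j = State.α x j) ∧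
      (∀ e, (G.Cᵀ *ᵥ State.ω x) e = 0) ∧ (∑ j, (G.dispatch ρ x j - G.d j) = 0) ∧
      (∀ j, G.dispatch ρ x j - G.d j - G.D j * State.ω x j
        - ((G.C * diagonal G.B) *ᵥ State.θ x) j = 0) ∧
      (∀ j, G.dispatch ρ x j = G.invMarginalCost j (G.price x j)) ∧
      ∀ e, G.congestion ρ x e ≤ 0 ∧ State.η x e * G.congestion ρ x e = 0 := by
  refine and_congr_right fun hη => ?_
  have h6 : ∀ e, (G.congestion ρ x e ≤ 0 ∧ State.η x e * G.congestion ρ x e = 0) ↔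
      posProj ((G.Hᵀ *ᵥ (G.dispatch ρ x - G.d)) e - G.F e) (State.η x e) / G.τη e = 0 :=
    fun e => by
      rw [div_eq_zero_iff, or_iff_left (G.τη_pos e).ne', posProj_eq_zero_iff (hη e)]
      rfl
  have hj : ∀ a b : ℝ, b ≠ 0 → (a / b = 0 ↔ a = 0) := fun a b hb => by simp [hb]
  simp only [h6, field, Prod.ext_iff, funext_iff, Prod.fst_zero, Prod.snd_zero, Pi.zero_apply,
    hj _ _ (G.τq_pos _).ne', hj _ _ (G.τl_pos).ne', hj _ _ (G.M_pos _).ne',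
    hj _ _ (G.τα_pos _).ne', sub_eq_zero (a := G.price x _), neg_eq_zero,
    sub_eq_zero (b := G.invMarginalCost _ _), and_assoc]

/-- Equilibria of the loop solve the planner's problem. -/
theorem isOptimalPrimalDual_of_mem_equilibriumSet {ρ : ℝ} {x : G.State}
    (hx : x ∈ G.equilibriumSet ρ) : G.IsOptimalPrimalDual (G.primalOf ρ x) (G.dualOf x) := by
  obtain ⟨hη, hα, hC, hbal, hnod, hq, hcong⟩ := G.mem_equilibriumSet_iff.1 hx
  have hfeas : (G.primalOf ρ x).Feasible :=
    ⟨funext hq, hbal, fun e => sub_nonpos.1 (hcong e).1, hnod⟩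
  have hval : ∀ P : G.Primal, P.Feasible → ∀ Y : G.Dual, lagrangian P Y
      = P.objective + ∑ e, Y.η e * ((G.Hᵀ *ᵥ (P.q - G.d)) e - G.F e) := fun P hP Y => by
    have h : ∀ j, P.q j - P.p j = 0 := fun j => by rw [hP.dispatch, sub_self]
    simp only [lagrangian, hP.nodal, hP.balance, h, mul_zero, Finset.sum_const_zero, add_zero,
      sub_zero]
  have hopt : lagrangian (G.primalOf ρ x) (G.dualOf x) = (G.primalOf ρ x).objective := by
    rw [hval _ hfeas, add_eq_left]
    exact Finset.sum_eq_zero fun e _ => (hcong e).2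
  -- At an equilibrium `Cᵀ ω = 0`, so `θ̃` drops out and the Lagrangian splits into a sum over
  -- buses.
  have hL : ∀ P : G.Primal, lagrangian P (G.dualOf x) = ∑ j, (G.cost j (P.p j)
      + 1 / 2 * (G.D j * P.ω j ^ 2) + State.ω x j * (P.q j - G.d j - G.D j * P.ω j)
      + State.α x j * (P.q j - P.p j) - State.l x * (P.q j - G.d j)
      + (P.q j - G.d j) * (G.H *ᵥ State.η x) j) - ∑ e, State.η x e * G.F e := fun P => by
    have hA1 := G.sum_B_mul_transpose_C (State.ω x) P.θ
    have hA2 := G.sum_mul_transpose_H (State.η x) (P.q - G.d)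
    simp only [hC, mul_zero, Finset.sum_const_zero] at hA1
    simp only [Pi.sub_apply] at hA2
    have hA3 : ∑ j, State.ω x j * (P.q j - G.d j - G.D j * P.ω j
        - ((G.C * diagonal G.B) *ᵥ P.θ) j)
        = ∑ j, State.ω x j * (P.q j - G.d j - G.D j * P.ω j) := by
      rw [← sub_zero (∑ j, State.ω x j * (P.q j - G.d j - G.D j * P.ω j)), hA1,
        ← Finset.sum_sub_distrib]
      exact Finset.sum_congr rfl fun j _ => by ring
    simp only [lagrangian, Primal.objective, dualOf, Finset.sum_add_distrib,
      Finset.sum_sub_distrib, ← Finset.mul_sum, mul_sub (State.η x _), hA2, hA3]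
    ring
  have hsaddle : ∀ P : G.Primal,
      (G.primalOf ρ x).objective ≤ lagrangian P (G.dualOf x) := fun P => by
    rw [← hopt, hL, hL]
    refine sub_le_sub_right (Finset.sum_le_sum fun j _ => ?_) _
    simp only [primalOf, ← hq]
    have h1 := (G.price_eq_iff_eq_invMarginalCost).1 (hq j)
    have h3 : State.l x = State.α x j + (G.H *ᵥ State.η x) j + State.ω x j := by
      rw [← hα, price]; ring
    -- The coefficient of the free `q` vanishes by the price formula. The gap at bus `j` is then
    -- half the sum of the two squares below.
    have h5 := mul_nonneg (G.c_pos j).le (sq_nonneg (P.p j - G.dispatch ρ x j))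
    have h6 := mul_nonneg (G.D_pos j).le (sq_nonneg (P.ω j - State.ω x j))
    rw [h3, ← hα, h1]
    simp only [cost]
    linarith
  refine ⟨hfeas, fun P hP => ?_, hη, fun P => hopt.trans_le (hsaddle P), fun Y hY => ?_⟩
  · refine (hsaddle P).trans ?_
    rw [hval P hP]
    have : ∑ e, (G.dualOf x).η e * ((G.Hᵀ *ᵥ (P.q - G.d)) e - G.F e) ≤ 0 :=
      Finset.sum_nonpos fun e _ =>
        mul_nonpos_of_nonneg_of_nonpos (hη e) (sub_nonpos.2 (hP.thermal e))
    linarith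
  · rw [hopt, hval _ hfeas]
    have : ∑ e, Y.η e * ((G.Hᵀ *ᵥ ((G.primalOf ρ x).q - G.d)) e - G.F e) ≤ 0 :=
      Finset.sum_nonpos fun e _ =>
        mul_nonpos_of_nonneg_of_nonpos (hY e) (sub_nonpos.2 (hfeas.thermal e))
    linarith

theorem hasFDerivAt_sum_cost (q : N → ℝ) :
    HasFDerivAt (fun q : N → ℝ => ∑ j, G.cost j (q j))
      (∑ j, (G.c j * q j + G.cbar j) • ContinuousLinearMap.proj (R := ℝ) (φ := fun _ : N => ℝ) j)
      q := by
  refine HasFDerivAt.fun_sum fun j _ => ?_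
  have h : HasDerivAt (G.cost j) (G.c j * q j + G.cbar j) (q j) := by
    have h1 := ((hasDerivAt_pow 2 (q j)).const_mul (G.c j / 2)).add
      ((hasDerivAt_id (q j)).const_mul (G.cbar j))
    exact h1.congr_deriv (by simp; ring)
  exact h.comp_hasFDerivAt q (ContinuousLinearMap.proj (R := ℝ) (φ := fun _ : N => ℝ) j).hasFDerivAt

/-- The generation cost attains its minimum on nonempty closed sets. -/
theorem exists_isMinOn_sum_cost {S : Set (N → ℝ)} (hS : IsClosed S) (hne : S.Nonempty) :
    ∃ q ∈ S, IsMinOn (fun q : N → ℝ => ∑ j, G.cost j (q j)) S q := by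
  obtain ⟨q₀, hq₀⟩ := hne
  have hcont : Continuous fun q : N → ℝ => ∑ j, G.cost j (q j) :=
    continuous_iff_continuousAt.2 fun q => (G.hasFDerivAt_sum_cost q).continuousAt
  refine hcont.continuousOn.exists_isMinOn' hS hq₀ (Filter.Eventually.filter_mono inf_le_left ?_)
  set A := ∑ j, G.cost j (q₀ j) + ∑ j, G.cbar j ^ 2 / G.c j
  have hlow : ∀ j a, G.c j / 4 * a ^ 2 - G.cbar j ^ 2 / G.c j ≤ G.cost j a := fun j a => by
    have hc := G.c_pos j
    have h1 : G.cost j a - (G.c j / 4 * a ^ 2 - G.cbar j ^ 2 / G.c j)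
        = (G.c j * a + 2 * G.cbar j) ^ 2 / (4 * G.c j) := by
      rw [cost]; field_simp; ring
    have h2 : 0 ≤ (G.c j * a + 2 * G.cbar j) ^ 2 / (4 * G.c j) := by positivity
    linarith
  -- Outside this box some `|q j|` exceeds `1`, hence `q j ^ 2 ≥ |q j|`, and exceeds `4 * A / c j`,
  -- so the quadratic lower bound alone reaches `A`.
  set R : N → ℝ := fun j => max 1 (4 * A / G.c j)
  have hK : IsCompact (Set.univ.pi fun j => Set.Icc (-R j) (R j)) :=
    isCompact_univ_pi fun _ => isCompact_Icc
  filter_upwards [hK.compl_mem_cocompact] with q hq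
  simp only [Set.mem_compl_iff, Set.mem_univ_pi, not_forall, ← abs_le, not_le, Set.mem_Icc] at hq
  obtain ⟨j, hj⟩ := hq
  have h1 : 1 < |q j| := (le_max_left _ _).trans_lt hj
  have h2 : 4 * A / G.c j < |q j| := (le_max_right _ _).trans_lt hj
  rw [div_lt_iff₀ (G.c_pos j)] at h2
  have h3 : A ≤ G.c j / 4 * q j ^ 2 := by
    rw [← sq_abs]
    nlinarith [mul_pos (G.c_pos j) (sub_pos.2 h1)]
  have h4 : G.c j / 4 * q j ^ 2 ≤ ∑ i, G.c i / 4 * q i ^ 2 :=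
    Finset.single_le_sum (f := fun i => G.c i / 4 * q i ^ 2)
      (fun i _ => mul_nonneg (by linarith [G.c_pos i]) (sq_nonneg _)) (Finset.mem_univ j)
  have h5 := Finset.sum_le_sum fun i (_ : i ∈ Finset.univ) => hlow i (q i)
  rw [Finset.sum_sub_distrib] at h5
  simp only [A] at h3
  linarith

/-- If the planner's problem is feasible, then the loop has an equilibrium. -/
theorem equilibriumSet_nonempty (hfeas : ∃ P : G.Primal, P.Feasible) (ρ : ℝ) :
    (G.equilibriumSet ρ).Nonempty := by
  obtain ⟨P, hP⟩ := hfeas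
  let s : (N → ℝ) →L[ℝ] ℝ := ∑ j, ContinuousLinearMap.proj (R := ℝ) (φ := fun _ : N => ℝ) j
  let h : G.lines ⊕ G.lines → (N → ℝ) →L[ℝ] ℝ := fun e =>
    (ContinuousLinearMap.proj (R := ℝ) (φ := fun _ : G.lines ⊕ G.lines => ℝ) e).comp
      (LinearMap.toContinuousLinearMap (G.Hᵀ.mulVecLin))
  -- The power balance is encoded as two opposite inequalities indexed by `Bool`; `λ`, which has no
  -- sign, is later the difference of their multipliers.
  let a : Bool ⊕ (G.lines ⊕ G.lines) → (N → ℝ) →L[ℝ] ℝ :=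
    Sum.elim (fun i => if i then s else -s) h
  let β : Bool ⊕ (G.lines ⊕ G.lines) → ℝ :=
    Sum.elim (fun i => if i then s G.d else -(s G.d)) fun e => G.F e + h e G.d
  have hs : ∀ v, s v = ∑ j, v j := fun v => by simp [s]
  have hh : ∀ e v, h e v = (G.Hᵀ *ᵥ v) e := fun e v => rfl
  have hmem : ∀ q, (∀ i, a i q ≤ β i) ↔
      ∑ j, (q j - G.d j) = 0 ∧ ∀ e, (G.Hᵀ *ᵥ (q - G.d)) e ≤ G.F e := fun q => by
    simp only [Sum.forall, Bool.forall_bool, a, β, Sum.elim_inl, Sum.elim_inr, if_true,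
      Bool.false_eq_true, if_false, _root_.neg_apply, neg_le_neg_iff, hs, hh,
      mulVec_sub, Pi.sub_apply, Finset.sum_sub_distrib, sub_le_iff_le_add, sub_eq_zero]
    rw [le_antisymm_iff, and_comm (a := _ ≤ ∑ j, q j)]
  have hclosed : IsClosed {q | ∀ i, a i q ≤ β i} := by
    simp only [Set.ofPred_forall]
    exact isClosed_iInter fun i => isClosed_le (a i).continuous continuous_const
  obtain ⟨q, hqS, hqmin⟩ := G.exists_isMinOn_sum_cost hclosed
    ⟨P.q, (hmem _).2 ⟨hP.balance, hP.thermal⟩⟩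
  obtain ⟨μ, hμ, hcs, hst⟩ := exists_kkt_multipliers hqS (G.hasFDerivAt_sum_cost q)
    fun y hy => hqmin hy
  obtain ⟨hbal, hth⟩ := (hmem q).1 hqS
  obtain ⟨θ, hθ⟩ := G.exists_C_mul_diagonal_mulVec_eq (v := q - G.d) hbal
  set η : G.lines ⊕ G.lines → ℝ := fun e => μ (Sum.inr e)
  set l : ℝ := μ (Sum.inl false) - μ (Sum.inl true)
  have hgrad : ∀ j, l - (G.H *ᵥ η) j = G.c j * q j + G.cbar j := fun j => by
    have h1 := hst (Pi.single j 1)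
    have h2 := G.sum_mul_transpose_H η (Pi.single j 1)
    simp only [Fintype.sum_sum_type, a, Sum.elim_inl, Sum.elim_inr, Fintype.sum_bool, if_true,
      Bool.false_eq_true, if_false, _root_.neg_apply, hs, hh] at h1
    rw [Fintype.sum_sum_type] at h2
    change ∑ a₁, μ (Sum.inr (Sum.inl a₁)) * (G.Hᵀ *ᵥ Pi.single j 1) (Sum.inl a₁) +
          ∑ a₂, μ (Sum.inr (Sum.inr a₂)) * (G.Hᵀ *ᵥ Pi.single j 1) (Sum.inr a₂) = _ at h2
    rw [h2] at h1
    simp [Pi.single_apply] at h1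
    simp only [l]
    linarith
  set α : N → ℝ := fun j => G.c j * q j + G.cbar j
  -- Zero frequency deviation, virtual dispatch equal to the optimal one, and bids equal to marginal
  -- costs; the last makes the regularizing term in the dispatch vanish.
  let x : G.State := ((q, θ), (l, 0, α, η))
  have hprice : ∀ j, G.price x j = G.c j * q j + G.cbar j := fun j => by
    rw [← hgrad]
    simp [price, x, State.l, State.η, State.ω]
  have hdisp : G.dispatch ρ x = q := by
    funext j
    rw [dispatch, hprice]
    simp [x, State.α, State.qhat, α]
  refine ⟨x, G.mem_equilibriumSet_iff.2 ⟨fun e => hμ _, hprice, fun e => ?_, ?_, fun j => ?_,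
    fun j => ?_, fun e => ⟨?_, ?_⟩⟩⟩
  · simp [x, State.ω]
  · rw [hdisp]; exact hbal
  · rw [hdisp]
    simp [x, State.ω, State.θ, hθ]
  · rw [hdisp, G.price_eq_iff_eq_invMarginalCost, hprice]
  · rw [congestion, hdisp, sub_nonpos]; exact hth e
  · have h1 := hcs (Sum.inr e)
    simp only [a, β, Sum.elim_inr, hh] at h1
    rw [congestion, hdisp, mulVec_sub, Pi.sub_apply, ← h1]
    simp only [x, State.η, η]
    ring

end equilibrium

end PowerMarket

/-! ### Invariance, nonexpansiveness and existence of trajectories -/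

/-- A locally absolutely continuous function that starts nonnegative and whose derivative is
almost everywhere nonnegative where the function is negative stays nonnegative. -/
theorem nonneg_of_ae_hasDerivAt_nonneg {g g' : ℝ → ℝ}
    (hg : ∀ T : ℝ, 0 ≤ T → AbsolutelyContinuousOnInterval g 0 T) (h0 : 0 ≤ g 0)
    (hd : ∀ᵐ t ∂(volume.restrict (Set.Ici (0 : ℝ))),
      HasDerivAt g (g' t) t ∧ (g t < 0 → 0 ≤ g' t)) {t : ℝ} (ht : 0 ≤ t) : 0 ≤ g t := by
  by_contra hneg
  rw [not_le] at hneg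
  have hcont : ContinuousOn g (Set.Icc 0 t) :=
    (AbsolutelyContinuousOnInterval.continuousOn_Ici hg).mono Set.Icc_subset_Ici_self
  have hK : IsCompact (Set.Icc 0 t ∩ g ⁻¹' Set.Ici 0) :=
    isCompact_Icc.of_isClosed_subset (hcont.preimage_isClosed_of_isClosed isClosed_Icc isClosed_Ici)
      Set.inter_subset_left
  -- `s` is the last time up to `t` at which `g` is nonnegative; afterwards `g` is negative, hence
  -- cannot decrease.
  obtain ⟨s, ⟨hs, hgs⟩, hmax⟩ := hK.exists_isGreatest ⟨0, ⟨le_rfl, ht⟩, h0⟩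
  have hgs0 : 0 ≤ g s := hgs
  have hac : AbsolutelyContinuousOnInterval g s t := (hg t ht).mono (by
    rw [Set.uIcc_of_le hs.2, Set.uIcc_of_le ht]; exact Set.Icc_subset_Icc_left hs.1)
  have h1 := hac.integral_deriv_eq_sub
  have h2 : 0 ≤ ∫ u in s..t, deriv g u := by
    rw [intervalIntegral.integral_of_le hs.2]
    apply integral_nonneg_of_ae
    have hsub : Set.Ioc s t ⊆ Set.Ici 0 := fun u hu => hs.1.trans hu.1.le
    filter_upwards [ae_restrict_of_ae_restrict_of_subset hsub hd,
      ae_restrict_mem measurableSet_Ioc] with u hu hmem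
    rw [Pi.zero_apply, hu.1.deriv]
    refine hu.2 (not_le.1 fun hcon => hmem.1.not_ge ?_)
    exact hmax ⟨⟨hs.1.trans hmem.1.le, hmem.2⟩, hcon⟩
  linarith

theorem AbsolutelyContinuousOnInterval.comp_const_add {X : Type*} [PseudoMetricSpace X]
    {x : ℝ → X} {a b c : ℝ} (hx : AbsolutelyContinuousOnInterval x (c + a) (c + b)) :
    AbsolutelyContinuousOnInterval (fun t => x (c + t)) a b := by
  rw [absolutelyContinuousOnInterval_iff] at hx ⊢
  intro ε hε
  obtain ⟨δ, hδ, h⟩ := hx ε hε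
  refine ⟨δ, hδ, fun E hE hEδ => ?_⟩
  refine h (E.1, fun i => (c + (E.2 i).1, c + (E.2 i).2)) ⟨fun i hi => ?_, fun i hi j hj hij => ?_⟩
    (by simpa using hEδ)
  · have := hE.1 i hi
    simpa [Set.mem_uIcc] using this
  · have h1 := hE.2 hi hj hij
    rw [Function.onFun, Set.disjoint_left] at h1 ⊢
    intro r hr hr'
    refine h1 (a := r - c) ?_ ?_
    · simp only [Set.mem_uIoc] at hr ⊢
      rcases hr with hr | hr
      · exact Or.inl ⟨by linarith [hr.1], by linarith [hr.2]⟩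
      · exact Or.inr ⟨by linarith [hr.1], by linarith [hr.2]⟩
    · simp only [Set.mem_uIoc] at hr' ⊢
      rcases hr' with hr | hr
      · exact Or.inl ⟨by linarith [hr.1], by linarith [hr.2]⟩
      · exact Or.inr ⟨by linarith [hr.1], by linarith [hr.2]⟩

theorem posProj_div {y u τ : ℝ} (hτ : 0 < τ) : posProj (y / τ) u = posProj y u / τ := by
  simp only [posProj, div_pos_iff_of_pos_right hτ]
  split_ifs <;> simp

namespace PowerMarket

section trajectories

variable {N : Type*} [Fintype N] [DecidableEq N] {G : PowerMarket N} {ρ : ℝ}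

theorem IsTrajectory.continuousOn {x : ℝ → G.State} (hx : G.IsTrajectory ρ x) :
    ContinuousOn x (Set.Ici 0) :=
  AbsolutelyContinuousOnInterval.continuousOn_Ici hx.absolutelyContinuous

theorem IsTrajectory.const_add {x : ℝ → G.State} (hx : G.IsTrajectory ρ x) {a : ℝ} (ha : 0 ≤ a) :
    G.IsTrajectory ρ fun t => x (a + t) := by
  refine ⟨fun T hT => ?_, ?_⟩
  · refine AbsolutelyContinuousOnInterval.comp_const_add
      ((hx.absolutelyContinuous (a + T) (add_nonneg ha hT)).mono ?_)
    rw [Set.uIcc_of_le (by linarith), Set.uIcc_of_le (by linarith)]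
    exact Set.Icc_subset_Icc_left (by linarith)
  · have h1 := (ae_restrict_iff' measurableSet_Ici).1 hx.ode
    have h2 := (measurePreserving_add_left volume a).quasiMeasurePreserving.ae h1
    rw [ae_restrict_iff' measurableSet_Ici]
    filter_upwards [h2] with t ht ht0
    exact (ht (add_nonneg ha ht0)).comp_const_add a t

theorem isTrajectory_const {x : G.State} (hx : x ∈ G.equilibriumSet ρ) :
    G.IsTrajectory ρ fun _ => x :=
  ⟨fun _ _ => (LipschitzWith.const x).lipschitzOnWith.absolutelyContinuousOnInterval,
    Eventually.of_forall fun t => by rw [hx.2]; exact hasDerivAt_const t x⟩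

/-- Trajectories do not leave the set where the multipliers are nonnegative. -/
theorem IsTrajectory.mem_initialSet {x : ℝ → G.State} (hx : G.IsTrajectory ρ x)
    (h0 : x 0 ∈ G.initialSet) {t : ℝ} (ht : 0 ≤ t) : x t ∈ G.initialSet := fun e => by
  let φ : G.State →ₗ[ℝ] ℝ := ⟨⟨fun x => State.η x e, fun _ _ => rfl⟩, fun _ _ => rfl⟩
  refine nonneg_of_ae_hasDerivAt_nonneg (g := fun s => φ (x s))
    (g' := fun s => φ (G.field ρ (x s))) (fun T hT =>
      (hx.absolutelyContinuous T hT).contDiff_comp φ.toContinuousLinearMap.contDiff) (h0 e) ?_ ht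
  filter_upwards [hx.ode] with s hs
  refine ⟨hasDerivAt_linearMap_comp hs φ, fun hneg => ?_⟩
  have hneg' : State.η (x s) e < 0 := hneg
  change 0 ≤ posProj _ _ / _
  refine div_nonneg ?_ (G.τη_pos e).le
  unfold posProj
  split_ifs with h
  · exact (h.resolve_right hneg'.not_gt).le
  · exact le_rfl

theorem antitoneOn_energy_sub (hρ : 0 < ρ) (hρc : ∀ j, ρ < 4 * G.c j) {x y : ℝ → G.State}
    (hx : G.IsTrajectory ρ x) (hy : G.IsTrajectory ρ y) (hx0 : x 0 ∈ G.initialSet)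
    (hy0 : y 0 ∈ G.initialSet) : AntitoneOn (fun t => G.energy (x t - y t)) (Set.Ici 0) := by
  refine antitoneOn_of_ae_hasDerivAt_nonpos (g' := fun t =>
    2 * G.weightedInner (x t - y t) (G.field ρ (x t) - G.field ρ (y t))) (fun T hT =>
      ((hx.absolutelyContinuous T hT).sub (hy.absolutelyContinuous T hT)).contDiff_comp
        G.contDiff_energy) ?_
  filter_upwards [hx.ode, hy.ode, ae_restrict_Ici_zero_pos] with t htx hty ht
  refine ⟨G.hasDerivAt_energy (htx.sub hty), ?_⟩
  have := weightedInner_field_nonpos hρ hρc (hx.mem_initialSet hx0 ht.le)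
    (hy.mem_initialSet hy0 ht.le)
  linarith

/-- Distances of trajectories grow at most by a constant factor. -/
theorem exists_dist_le_mul_dist (hρ : 0 < ρ) (hρc : ∀ j, ρ < 4 * G.c j) :
    ∃ K > 0, ∀ x y : ℝ → G.State, G.IsTrajectory ρ x → G.IsTrajectory ρ y →
      x 0 ∈ G.initialSet → y 0 ∈ G.initialSet → ∀ s t, 0 ≤ s → s ≤ t →
      dist (x t) (y t) ≤ K * dist (x s) (y s) := by
  obtain ⟨m, hm, M, hM, hmM⟩ := G.exists_energy_bounds
  -- The energy distance never grows; the factor only accounts for comparing the energy with the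
  -- squared norm.
  refine ⟨Real.sqrt (M / m), Real.sqrt_pos.2 (div_pos hM hm), fun x y hx hy hx0 hy0 s t hs hst => ?_⟩
  have h1 := antitoneOn_energy_sub hρ hρc hx hy hx0 hy0 hs (hs.trans hst) hst
  have h2 := (hmM (x t - y t)).1
  have h3 := (hmM (x s - y s)).2
  rw [dist_eq_norm, dist_eq_norm]
  refine abs_le_of_sq_le_sq' ?_ (by positivity) |>.2
  rw [mul_pow, Real.sq_sqrt (by positivity), div_mul_eq_mul_div, le_div_iff₀ hm]
  dsimp only at h1
  linarith

/-- The right-hand side without the projection of the multiplier dynamics. -/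
noncomputable def freeField (G : PowerMarket N) (ρ : ℝ) (x : G.State) : G.State :=
  ((fun j => (G.price x j - State.α x j) / G.τq j,
    G.Cᵀ *ᵥ State.ω x),
   (-(∑ j, (G.dispatch ρ x j - G.d j)) / G.τl,
    fun j => (G.dispatch ρ x j - G.d j - G.D j * State.ω x j
      - ((G.C * diagonal G.B) *ᵥ State.θ x) j) / G.M j,
    fun j => (G.dispatch ρ x j - G.invMarginalCost j (G.price x j)) / G.τα j,
    fun e => ((G.Hᵀ *ᵥ (G.dispatch ρ x - G.d)) e - G.F e) / G.τη e))

theorem price_add (x y : G.State) (j : N) : G.price (x + y) j = G.price x j + G.price y j := by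
  have h : G.H *ᵥ State.η (x + y) = G.H *ᵥ State.η x + G.H *ᵥ State.η y := mulVec_add _ _ _
  have h1 : State.l (x + y) = State.l x + State.l y := rfl
  have h2 : State.ω (x + y) j = State.ω x j + State.ω y j := rfl
  rw [price, price, price, h, h1, h2, Pi.add_apply]
  ring

theorem price_smul (a : ℝ) (x : G.State) (j : N) : G.price (a • x) j = a * G.price x j := by
  have h : G.H *ᵥ State.η (a • x) = a • (G.H *ᵥ State.η x) := mulVec_smul _ _ _
  have h1 : State.l (a • x) = a * State.l x := rfl
  have h2 : State.ω (a • x) j = a * State.ω x j := rfl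
  rw [price, price, h, h1, h2, Pi.smul_apply, smul_eq_mul]
  ring

theorem dispatch_add (x y : G.State) :
    G.dispatch ρ (x + y) = G.dispatch ρ x + G.dispatch ρ y := by
  funext j
  have h1 : State.α (x + y) j = State.α x j + State.α y j := rfl
  have h2 : State.qhat (x + y) j = State.qhat x j + State.qhat y j := rfl
  rw [Pi.add_apply, dispatch, dispatch, dispatch, price_add, h1, h2]
  ring

theorem dispatch_smul (a : ℝ) (x : G.State) : G.dispatch ρ (a • x) = a • G.dispatch ρ x := by
  funext j
  have h1 : State.α (a • x) j = a * State.α x j := rfl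
  have h2 : State.qhat (a • x) j = a * State.qhat x j := rfl
  rw [Pi.smul_apply, smul_eq_mul, dispatch, dispatch, price_smul, h1, h2]
  ring

/-- The linear part of `freeField`. -/
noncomputable def freeFieldLinear (G : PowerMarket N) (ρ : ℝ) : G.State →ₗ[ℝ] G.State where
  toFun x :=
    ((fun j => (G.price x j - State.α x j) / G.τq j,
      G.Cᵀ *ᵥ State.ω x),
     (-(∑ j, G.dispatch ρ x j) / G.τl,
      fun j => (G.dispatch ρ x j - G.D j * State.ω x j
        - ((G.C * diagonal G.B) *ᵥ State.θ x) j) / G.M j,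
      fun j => (G.dispatch ρ x j - G.price x j / G.c j) / G.τα j,
      fun e => (G.Hᵀ *ᵥ G.dispatch ρ x) e / G.τη e))
  map_add' x y := by
    have hα : ∀ j, State.α (x + y) j = State.α x j + State.α y j := fun j => rfl
    have hω : State.ω (x + y) = State.ω x + State.ω y := rfl
    have hθ : State.θ (x + y) = State.θ x + State.θ y := rfl
    refine Prod.ext (Prod.ext (funext fun j => ?_) (funext fun e => ?_)) (Prod.ext ?_ (Prod.ext
      (funext fun j => ?_) (Prod.ext (funext fun j => ?_) (funext fun e => ?_))))
    all_goals simp only [hα, hω, hθ, price_add, dispatch_add, mulVec_add, Prod.fst_add,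
      Prod.snd_add, Pi.add_apply, Finset.sum_add_distrib]
    all_goals ring
  map_smul' a x := by
    have hα : ∀ j, State.α (a • x) j = a * State.α x j := fun j => rfl
    have hω : State.ω (a • x) = a • State.ω x := rfl
    have hθ : State.θ (a • x) = a • State.θ x := rfl
    refine Prod.ext (Prod.ext (funext fun j => ?_) (funext fun e => ?_)) (Prod.ext ?_ (Prod.ext
      (funext fun j => ?_) (Prod.ext (funext fun j => ?_) (funext fun e => ?_))))
    all_goals simp only [hα, hω, hθ, price_smul, dispatch_smul, mulVec_smul, Prod.smul_fst,
      Prod.smul_snd, Pi.smul_apply, smul_eq_mul, ← Finset.mul_sum, RingHom.id_apply]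
    all_goals ring

theorem freeField_sub (x y : G.State) :
    G.freeField ρ x - G.freeField ρ y = G.freeFieldLinear ρ (x - y) := by
  rw [map_sub]
  refine Prod.ext (Prod.ext (funext fun j => ?_) (funext fun e => ?_)) (Prod.ext ?_ (Prod.ext
    (funext fun j => ?_) (Prod.ext (funext fun j => ?_) (funext fun e => ?_))))
  all_goals simp only [freeField, freeFieldLinear, LinearMap.coe_mk, AddHom.coe_mk, Prod.fst_sub,
    Prod.snd_sub, Pi.sub_apply, Finset.sum_sub_distrib, mulVec_sub, invMarginalCost]
  all_goals ring

/-- Without the projection the right-hand side is affine, so the operator norm of its linear part is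
a global Lipschitz constant. -/
theorem exists_lipschitzWith_freeField : ∃ L, LipschitzWith L (G.freeField ρ) := by
  refine ⟨‖(G.freeFieldLinear ρ).toContinuousLinearMap‖₊, LipschitzWith.of_dist_le_mul
    fun x y => ?_⟩
  rw [dist_eq_norm, dist_eq_norm, freeField_sub]
  exact (G.freeFieldLinear ρ).toContinuousLinearMap.le_opNorm (x - y)

/-- Global existence of trajectories. -/
theorem exists_isTrajectory {x₀ : G.State} (h₀ : x₀ ∈ G.initialSet) :
    ∃ x, G.IsTrajectory ρ x ∧ x 0 = x₀ := by
  obtain ⟨L, hL⟩ := exists_lipschitzWith_freeField (G := G) (ρ := ρ)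
  let φ : G.lines ⊕ G.lines → G.State →L[ℝ] ℝ := fun e => LinearMap.toContinuousLinearMap
    ⟨⟨fun x => State.η x e, fun _ _ => rfl⟩, fun _ _ => rfl⟩
  -- Each multiplier is reflected along its own coordinate axis, so the reflection leaves all other
  -- components untouched.
  let b : G.lines ⊕ G.lines → G.State := fun e => ((0, 0), (0, 0, 0, Pi.single e 1))
  have hφ : ∀ e x, φ e x = State.η x e := fun _ _ => rfl
  obtain ⟨x, hx0, hac, hode⟩ := exists_projected_solution (φ := φ) (b := b)
    (fun e e' => by rw [hφ]; simp [b, State.η, Pi.single_apply]) hL (fun e => h₀ e)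
  refine ⟨x, ⟨hac, ?_⟩, hx0⟩
  filter_upwards [hode] with t ht
  have hsum : ∀ r : G.lines ⊕ G.lines → ℝ, ∑ e, r e • b e = ((0, 0), (0, 0, 0, r)) := fun r => by
    refine Prod.ext (Prod.ext ?_ ?_) (Prod.ext ?_ (Prod.ext ?_ (Prod.ext ?_ (funext fun e => ?_))))
    case refine_6 =>
      simp only [b, Prod.snd_sum, Prod.smul_snd, Finset.sum_apply, Pi.smul_apply, Pi.single_apply,
        smul_eq_mul, mul_ite, mul_one, mul_zero, Finset.sum_ite_eq, Finset.mem_univ, if_true]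
    all_goals simp [b, Prod.fst_sum, Prod.snd_sum]
  refine ht.congr_deriv ?_
  rw [hsum]
  refine Prod.ext (Prod.ext ?_ ?_) (Prod.ext ?_ (Prod.ext ?_ (Prod.ext ?_ (funext fun e => ?_))))
  case refine_6 =>
    have h1 : φ e (G.freeField ρ (x t))
        = ((G.Hᵀ *ᵥ (G.dispatch ρ (x t) - G.d)) e - G.F e) / G.τη e := rfl
    change φ e (G.freeField ρ (x t)) + (posProj (φ e (G.freeField ρ (x t))) (State.η (x t) e)
      - φ e (G.freeField ρ (x t))) = posProj _ _ / _
    rw [h1, posProj_div (G.τη_pos e)]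
    ring
  all_goals simp only [Prod.fst_add, Prod.snd_add, add_zero]
  all_goals rfl

end trajectories

end PowerMarket

/-! ### Convergence to a single equilibrium -/

namespace PowerMarket

section convergence

variable {N : Type*} [Fintype N] [DecidableEq N] {G : PowerMarket N} {ρ : ℝ}

theorem isClosed_initialSet : IsClosed G.initialSet := by
  have h : G.initialSet = ⋂ e, {x : G.State | 0 ≤ State.η x e} := by
    ext x
    simp [initialSet]
  rw [h]
  refine isClosed_iInter fun e => isClosed_le continuous_const ?_
  unfold State.η
  fun_prop

/-- A trajectory at constant weighted distance from an equilibrium passes through equilibria. -/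
theorem IsTrajectory.exists_mem_equilibriumSet (hρ : 0 < ρ) (hρc : ∀ j, ρ < 4 * G.c j)
    {y : ℝ → G.State} (hy : G.IsTrajectory ρ y) (hy0 : y 0 ∈ G.initialSet) {x : G.State}
    (hx : x ∈ G.equilibriumSet ρ) {r : ℝ} (hr : ∀ t ≥ 0, G.energy (y t - x) = r) :
    ∃ t > 0, y t ∈ G.equilibriumSet ρ := by
  have hinner : ∀ᵐ t ∂(volume.restrict (Set.Ici (0 : ℝ))),
      G.weightedInner (y t - x) (G.field ρ (y t) - G.field ρ x) = 0 := by
    filter_upwards [hy.ode, ae_restrict_Ici_zero_pos] with t ht ht0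
    have h1 := G.hasDerivAt_energy (ht.sub_const x)
    have h2 : HasDerivAt (fun s => G.energy (y s - x)) 0 t :=
      (hasDerivAt_const t r).congr_of_eventuallyEq
        (eventually_of_mem (Ici_mem_nhds ht0) fun s hs => hr s hs)
    have h3 := h1.unique h2
    rw [hx.2, sub_zero]
    linarith
  have hpair : ∀ᵐ t ∂(volume.restrict (Set.Ici (0 : ℝ))), G.dissipation ρ (y t) x = 0 ∧
      ∀ e, (State.η (y t) e - State.η x e) *
        ((posProj (G.congestion ρ (y t) e) (State.η (y t) e) - G.congestion ρ (y t) e)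
          - (posProj (G.congestion ρ x e) (State.η x e) - G.congestion ρ x e)) = 0 := by
    filter_upwards [hinner, ae_restrict_Ici_zero_pos] with t ht ht0
    rw [G.weightedInner_sub_field_sub hρ] at ht
    have h1 := dissipation_nonneg hρ hρc (y t) x
    have hterm := fun e => sub_mul_posProj_sub_nonpos (y := G.congestion ρ (y t) e)
      (y' := G.congestion ρ x e) (hy.mem_initialSet hy0 ht0.le e) (hx.1 e)
    have h2 := Finset.sum_nonpos fun e (_ : e ∈ Finset.univ) => hterm e
    refine ⟨by linarith, fun e => ?_⟩
    exact (Finset.sum_eq_zero_iff_of_nonpos fun e _ => hterm e).1 (by linarith) e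
      (Finset.mem_univ e)
  have hcont := hy.continuousOn
  -- Vanishing dissipation fixes `ω` almost everywhere, and continuity upgrades this to all positive
  -- times. Frequencies and, likewise, bids are therefore constant, and their time derivatives
  -- vanish.
  have hω : ∀ t > 0, State.ω (y t) = State.ω x := by
    refine eq_of_ae_eq_of_continuousOn (f := fun t => State.ω (y t)) ?_ ?_
    · unfold State.ω; fun_prop
    · filter_upwards [hpair] with t ht
      exact funext fun j => (eq_of_dissipation_eq_zero hρ hρc ht.1 j).1
  have hα : ∀ t > 0, State.α (y t) = State.α x := by
    refine eq_of_ae_eq_of_continuousOn (f := fun t => State.α (y t)) ?_ ?_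
    · unfold State.α; fun_prop
    · filter_upwards [hpair] with t ht
      exact funext fun j => (eq_of_dissipation_eq_zero hρ hρc ht.1 j).2.2
  refine exists_pos_of_ae_restrict_Ici ?_
  filter_upwards [hy.ode, hpair, ae_restrict_Ici_zero_pos] with t ht htp ht0
  have hω' : ∀ j, State.ω (G.field ρ (y t)) j = 0 := fun j => by
    have h1 := hasDerivAt_linearMap_comp ht ⟨⟨fun x => State.ω x j, fun _ _ => rfl⟩,
      fun _ _ => rfl⟩
    refine h1.unique ((hasDerivAt_const t (State.ω x j)).congr_of_eventuallyEq ?_)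
    filter_upwards [Ioi_mem_nhds ht0] with s hs
    exact congrFun (hω s hs) j
  have hα' : ∀ j, State.α (G.field ρ (y t)) j = 0 := fun j => by
    have h1 := hasDerivAt_linearMap_comp ht ⟨⟨fun x => State.α x j, fun _ _ => rfl⟩,
      fun _ _ => rfl⟩
    refine h1.unique ((hasDerivAt_const t (State.α x j)).congr_of_eventuallyEq ?_)
    filter_upwards [Ioi_mem_nhds ht0] with s hs
    exact congrFun (hα s hs) j
  obtain ⟨hη, hxα, hxC, hxbal, hxnod, hxq, hxcong⟩ := G.mem_equilibriumSet_iff.1 hx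
  have hprice : ∀ j, G.price (y t) j = G.price x j := fun j =>
    (eq_of_dissipation_eq_zero hρ hρc htp.1 j).2.1
  have hq : ∀ j, G.dispatch ρ (y t) j = G.invMarginalCost j (G.price (y t) j) := fun j => by
    have h1 : (_ - _) / G.τα j = 0 := hα' j
    exact sub_eq_zero.1 ((div_eq_zero_iff.1 h1).resolve_right (G.τα_pos j).ne')
  have hdisp : G.dispatch ρ (y t) = G.dispatch ρ x :=
    funext fun j => by rw [hq, hprice, hxq]
  have hcong : ∀ e, G.congestion ρ (y t) e = G.congestion ρ x e := fun e => by
    rw [congestion, congestion, hdisp]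
  have hηt := hy.mem_initialSet hy0 ht0.le
  refine G.mem_equilibriumSet_iff.2 ⟨hηt, fun j => ?_, fun e => ?_, ?_, fun j => ?_, hq,
    fun e => ⟨?_, ?_⟩⟩
  · rw [hprice, hα t ht0, hxα]
  · rw [hω t ht0, hxC]
  · rw [hdisp, hxbal]
  · have h1 : _ / G.M j = 0 := hω' j
    exact (div_eq_zero_iff.1 h1).resolve_right (G.M_pos j).ne'
  · rw [hcong]; exact (hxcong e).1
  -- Where the multiplier of `y t` is positive its correction vanishes, so the vanishing product
  -- says that the difference of multipliers times the common congestion is zero. Complementarity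
  -- then passes from `x` to `y t`.
  · have h1 := htp.2 e
    rw [hcong, (posProj_eq_zero_iff (hη e)).2 (hxcong e)] at h1
    rw [hcong]
    rcases (hηt e).eq_or_lt with h | h
    · rw [← h, zero_mul]
    · have h2 := (posProj_sub_nonneg (y := G.congestion ρ x e)).2 h
      rw [sub_eq_zero] at h2
      rw [h2] at h1
      have h3 := (hxcong e).2
      linarith

/-- Every trajectory from the initial set converges to an equilibrium. -/
theorem IsTrajectory.exists_tendsto (hρ : 0 < ρ) (hρc : ∀ j, ρ < 4 * G.c j)
    {x : ℝ → G.State} (hx : G.IsTrajectory ρ x) (hx0 : x 0 ∈ G.initialSet)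
    (hne : (G.equilibriumSet ρ).Nonempty) :
    Bornology.IsBounded (x '' Set.Ici 0) ∧
      ∃ z ∈ G.equilibriumSet ρ, Tendsto x atTop (𝓝 z) := by
  obtain ⟨xs, hxs⟩ := hne
  obtain ⟨K, hK, hdist⟩ := exists_dist_le_mul_dist (G := G) hρ hρc
  have hcst : ∀ z ∈ G.equilibriumSet ρ, ∀ s t, 0 ≤ s → s ≤ t →
      dist (x t) z ≤ K * dist (x s) z := fun z hz =>
    hdist x (fun _ => z) hx (isTrajectory_const hz) hx0 hz.1
  have hbdd : Bornology.IsBounded (x '' Set.Ici 0) := by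
    refine (Metric.isBounded_iff_subset_closedBall xs).2 ⟨K * dist (x 0) xs, ?_⟩
    rintro _ ⟨t, ht, rfl⟩
    exact hcst xs hxs 0 t le_rfl ht
  refine ⟨hbdd, ?_⟩
  obtain ⟨y₀, -, φ, hφ, hlim⟩ := tendsto_subseq_of_bounded hbdd
    (x := fun n : ℕ => x n) fun n => Set.mem_image_of_mem x (Set.mem_Ici.2 n.cast_nonneg)
  have hy₀ : y₀ ∈ G.initialSet := isClosed_initialSet.mem_of_tendsto hlim
    (Eventually.of_forall fun n => hx.mem_initialSet hx0 (Nat.cast_nonneg _))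
  obtain ⟨y, hy, rfl⟩ := exists_isTrajectory (ρ := ρ) hy₀
  have hφt : Tendsto (fun n => ((φ n : ℕ) : ℝ)) atTop atTop :=
    tendsto_natCast_atTop_atTop.comp hφ.tendsto_atTop
  -- Nonexpansiveness carries convergence at time `0` to every later time, in place of continuous
  -- dependence on initial data.
  have hshift : ∀ s ≥ 0, Tendsto (fun n => x (φ n + s)) atTop (𝓝 (y s)) := fun s hs => by
    rw [tendsto_iff_dist_tendsto_zero] at hlim ⊢
    have h1 := hlim.const_mul K
    rw [mul_zero] at h1
    refine squeeze_zero (fun _ => dist_nonneg) (fun n => ?_) h1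
    have h2 := hdist _ y (hx.const_add (Nat.cast_nonneg (φ n))) hy
      (by rw [add_zero]; exact hx.mem_initialSet hx0 (Nat.cast_nonneg _)) hy₀ 0 s le_rfl hs
    simpa using h2
  have hanti := antitoneOn_energy_sub hρ hρc hx (isTrajectory_const hxs) hx0 hxs.1
  -- Trajectories are only controlled for nonnegative times; `max t 0` gives a function that is
  -- monotone on all of `ℝ`.
  have hanti' : Antitone fun t => G.energy (x (max t 0) - xs) := fun s t hst =>
    hanti (le_max_right s 0) (le_max_right t 0) (max_le_max_right 0 hst)
  obtain ⟨m, hm, _, _, hmM⟩ := G.exists_energy_bounds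
  have hVlim := tendsto_atTop_ciInf hanti' ⟨0, by
    rintro _ ⟨t, rfl⟩
    exact (by positivity : 0 ≤ m * ‖x (max t 0) - xs‖ ^ 2).trans (hmM _).1⟩
  set r := ⨅ t, G.energy (x (max t 0) - xs)
  have hconst : ∀ s ≥ 0, G.energy (y s - xs) = r := fun s hs => by
    have h1 : Tendsto (fun n => G.energy (x (φ n + s) - xs)) atTop (𝓝 (G.energy (y s - xs))) :=
      (G.contDiff_energy.continuous.tendsto _).comp ((hshift s hs).sub_const xs)
    have h2 := hVlim.comp (tendsto_atTop_add_const_right _ s hφt)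
    refine tendsto_nhds_unique h1 (h2.congr fun n => ?_)
    simp only [Function.comp_apply]
    rw [max_eq_left (by positivity)]
  obtain ⟨t, ht, hz⟩ := hy.exists_mem_equilibriumSet hρ hρc hy₀ hxs hconst
  refine ⟨y t, hz, Metric.tendsto_atTop.2 fun ε hε => ?_⟩
  -- The equilibrium `y t` is a limit point of `x`; once `x` is within `ε / K` of it, the distance
  -- stays below `ε`.
  obtain ⟨n, hn⟩ := ((Metric.tendsto_nhds.1 (hshift t ht.le)) (ε / K) (div_pos hε hK)).exists
  refine ⟨φ n + t, fun s hs => (hcst _ hz _ s (by positivity) hs).trans_lt ?_⟩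
  rwa [mul_comm, ← lt_div_iff₀ hK]

end convergence

end PowerMarket

theorem theorem5 {N : Type*} [Fintype N] [DecidableEq N] (G : PowerMarket N)
    (hfeas : ∃ P : G.Primal, P.Feasible)
    (ρ : ℝ) (hρ : ρ ∈ Set.Ioo 0 (⨅ j, 4 * G.c j)) :
    IsGloballyAsymptoticallyStableOn (G.IsTrajectory ρ) (G.equilibriumSet ρ) G.initialSet ∧
    ∀ x₀ ∈ G.initialSet,
      (∃ x : ℝ → G.State, G.IsTrajectory ρ x ∧ x 0 = x₀) ∧
      ∀ x : ℝ → G.State, G.IsTrajectory ρ x → x 0 = x₀ →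
        Bornology.IsBounded (x '' Set.Ici 0) ∧
        ∃ xs ∈ G.equilibriumSet ρ,
          G.IsOptimalPrimalDual (G.primalOf ρ xs) (G.dualOf xs) ∧
          Tendsto x atTop (𝓝 xs) := by
  have hρ0 : 0 < ρ := hρ.1
  have hρc : ∀ j, ρ < 4 * G.c j := fun j =>
    hρ.2.trans_le (ciInf_le (Set.finite_range _).bddBelow j)
  have hne := G.equilibriumSet_nonempty hfeas ρ
  refine ⟨⟨hne, fun ε hε => ?_, fun x hx hx0 => ?_⟩, fun x₀ hx₀ =>
    ⟨PowerMarket.exists_isTrajectory hx₀, ?_⟩⟩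
  · obtain ⟨K, hK, hdist⟩ := PowerMarket.exists_dist_le_mul_dist (G := G) hρ0 hρc
    refine ⟨ε / K, div_pos hε hK, fun x hx hx0 hδ t ht => ?_⟩
    obtain ⟨z, hz, hxz⟩ := (Metric.infDist_lt_iff hne).1 hδ
    refine (Metric.infDist_le_dist_of_mem hz).trans_lt ?_
    refine (hdist x (fun _ => z) hx (PowerMarket.isTrajectory_const hz) hx0 hz.1 0 t le_rfl
      ht).trans_lt ?_
    rwa [mul_comm, ← lt_div_iff₀ hK]
  · obtain ⟨-, z, hz, hlim⟩ := hx.exists_tendsto hρ0 hρc hx0 hne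
    rw [tendsto_iff_dist_tendsto_zero] at hlim
    exact squeeze_zero (fun _ => Metric.infDist_nonneg)
      (fun t => Metric.infDist_le_dist_of_mem hz) hlim
  · rintro x hx rfl
    obtain ⟨hbdd, z, hz, hlim⟩ := hx.exists_tendsto hρ0 hρc hx₀ hne
    exact ⟨hbdd, z, hz, G.isOptimalPrimalDual_of_mem_equilibriumSet hz, hlim⟩
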